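/- **Definitions.** Manifolds are smooth, without boundary, Hausdorff, second countable and connected. A spacetime $(M,g)$ is a manifold with a Lorentzian metric $g$ of signature $(-,+,\dots,+)$ and a time orientation, given by a continuous timelike vector field; it is smooth if $g$ is smooth. A metric (or function) is $C^{0,1}$ if its components (or the function) are locally Lipschitz in every coordinate system. On a spacetime with $C^{0,1}$ metric, a (future directed) causal curve is a locally Lipschitz curve whose velocity is future directed causal almost everywhere; $J^+(p)$ is the set consisting of $p$ and the end points of causal curves on compact intervals starting at $p$, and $J^-$ is defined dually. The spacetime is globally hyperbolic if it is strongly causal (every neighborhood $U$ of a point $p$ contains a neighborhood $V$ of $p$ such that causal curves with end points in $V$ stay in $U$) and $J^+(p)\cap J^-(q)$ is compact for all $p,q$. Let $n\ge 2$. A smooth spacetime $(M^{n+1},g)$ has $k$ *asymptotically $\mathrm{AdS}_2\times S^{n-1}$ ends* ($k\in\{1,2,\dots,\infty\}$) if there are a spacetime $(\overline M^{\,n+1},\overline g)$ with $C^{0,1}$ metric and a function $\Omega\in C^{0,1}(\overline M)$ such that 1. $(\overline M,\overline g)$ is globally hyperbolic; 2. $M\subset\overline M$ as an open submanifold with the same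 time orientation, and $\partial M=\mathcal J$, where $\mathcal J=\bigsqcup_{i=1}^k\mathcal J_i$ is a disjoint union of smooth timelike curves $\mathcal J_i$ inextendible in $\overline M$; 3. $\Omega|_M$ is smooth and positive, $\Omega=0$ on $\mathcal J$, and every $p\in\mathcal J$ has a neighborhood $U$ in $\overline M$ such that $U\cap\mathcal J$ is connected and $d\Omega$ exists and is bounded on $U\setminus\mathcal J$; 4. $\overline g=\Omega^2 g$ on $M$. **Corollary.** (a) Let $f$ be a smooth positive function on an interval $(r_0,\infty)$ with $f(r)=r^2+O(r)$ and $f'(r)=2r+O(1)$ as $r\to\infty$. Put $r(x)=-\tan(x-\pi/2)$ and $a(x)=\sqrt{f(r(x))}\,\sin^2x$ for small $x>0$. Then $a(x)=x+O(x^2)$ and, $a$ being differentiable for small $x>0$, $a'(x)=1+O(x)$ as $x\to0^+$. (b) Let $n\ge2$ and let $f:\mathbb R\to(0,\infty)$ be smooth with $f(r)=r^2+O(r)$ and $f'(r)=2r+O(1)$ both as $r\to\infty$ and as $r\to-\infty$. Then $\mathbb R\times\mathbb R\times S^{n-1}\ni(t,r,\omega)$ with the metric $$g=-f(r)\,dt^2+\frac1{f(r)}\,dr^2+d\omega_{n-1}^2,$$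 where $d\omega^2_{n-1}$ is the round metric of the unit sphere, time oriented by $\partial_t$, is a smooth spacetime with two asymptotically $\mathrm{AdS}_2\times S^{n-1}$ ends. -/

import Mathlib

open Set Filter Topology MeasureTheory Asymptotics
open scoped Manifold ContDiff Bundle

noncomputable section

namespace AdSEnds

section Spacetimes

variable {E : Type*} [NormedAddCommGroup E] [NormedSpace ℝ E]
  {H : Type*} [TopologicalSpace H] (I : ModelWithCorners ℝ E H)
  {M : Type*} [TopologicalSpace M] [ChartedSpace H M]

variable (M) in
/-- A field of bilinear forms on the tangent spaces of `M` (a `(0,2)`-tensor field, with no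
regularity imposed). -/
abbrev BilinField : Type _ :=
  ∀ x : M, TangentSpace I x →L[ℝ] (TangentSpace I x →L[ℝ] ℝ)

variable (M) in
/-- A vector field on `M` (with no regularity imposed). -/
abbrev VecField : Type _ := ∀ x : M, TangentSpace I x

/-- A Lorentzian scalar product, i.e. a symmetric bilinear form of signature `(-,+,…,+)`: there is
a vector on which it is negative and on whose orthogonal complement it is positive definite. -/
def IsLorentzForm {V : Type*} [NormedAddCommGroup V] [NormedSpace ℝ V]
    (b : V →L[ℝ] (V →L[ℝ] ℝ)) : Prop :=
  (∀ v w, b v w = b w v) ∧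
    ∃ v, b v v < 0 ∧ ∀ w, b v w = 0 → w ≠ 0 → 0 < b w w

/-- `M` with the (not yet necessarily regular) metric `g` and the vector field `T` is a spacetime of
dimension `n + 1`: a connected Hausdorff second countable manifold without boundary, a Lorentzian
scalar product on each tangent space, and a time orientation given by a continuous timelike vector
field `T`. Regularity of `g` is expressed by `IsSmoothMetric` and `IsLipschitzMetric`. -/
structure IsSpacetime [IsManifold I ∞ M] (n : ℕ) (g : BilinField I M) (T : VecField I M) :
    Prop where
  finrank_eq : Module.finrank ℝ E = n + 1
  boundaryless : I.Boundaryless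
  t2 : T2Space M
  secondCountable : SecondCountableTopology M
  connected : ConnectedSpace M
  lorentz : ∀ x, IsLorentzForm (V := E) (g x)
  timelike : ∀ x, g x (T x) (T x) < 0
  continuous_timeOrientation : Continuous (fun x => (⟨x, T x⟩ : TangentBundle I M))

/-- `g` is a smooth section of the bundle of bilinear forms on the tangent spaces. -/
def IsSmoothMetric [IsManifold I ∞ M] (g : BilinField I M) : Prop :=
  ContMDiff I (I.prod 𝓘(ℝ, E →L[ℝ] E →L[ℝ] ℝ)) ∞
    (fun x => Bundle.TotalSpace.mk' (E →L[ℝ] E →L[ℝ] ℝ)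
      (E := fun x : M => TangentSpace I x →L[ℝ] (TangentSpace I x →L[ℝ] ℝ)) x (g x))

/-- The component `g(∂_v, ∂_w)` of `g` in the coordinate system `e`, as a function of the
coordinates `y`; here `∂_v` is the coordinate vector field of the constant vector `v`. -/
def metricComponent (g : BilinField I M) (e : OpenPartialHomeomorph M H) (v w : E) (y : E) : ℝ :=
  let ψ : E → M := (e.extend I).symm
  let dψ : E →L[ℝ] TangentSpace I (ψ y) := mfderiv 𝓘(ℝ, E) I ψ y
  g (ψ y) (dψ v) (dψ w)

/-- `g` is `C^{0,1}`: in every coordinate system its components are locally Lipschitz. -/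
def IsLipschitzMetric (g : BilinField I M) : Prop :=
  ∀ e ∈ IsManifold.maximalAtlas I ∞ M, ∀ v w : E,
    LocallyLipschitzOn (e.extend I).target (metricComponent I g e v w)

/-- `Ω` is a `C^{0,1}` function: it is locally Lipschitz in every coordinate system. -/
def IsLipschitzFunction (Ω : M → ℝ) : Prop :=
  ∀ e ∈ IsManifold.maximalAtlas I ∞ M,
    LocallyLipschitzOn (e.extend I).target (Ω ∘ (e.extend I).symm)

/-- A future directed causal vector at `x`. A nonzero causal vector is never orthogonal to the
timelike vector `T x`, so the strict inequality also excludes the zero vector. -/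
def FutureCausal (g : BilinField I M) (T : VecField I M) (x : M) (v : TangentSpace I x) : Prop :=
  g x v v ≤ 0 ∧ g x v (T x) < 0

/-- A future directed timelike vector at `x`. -/
def FutureTimelike (g : BilinField I M) (T : VecField I M) (x : M) (v : TangentSpace I x) : Prop :=
  g x v v < 0 ∧ g x v (T x) < 0

/-- `γ : [a, b] → M` is a (future directed) causal curve: it is locally Lipschitz and its velocity
is future directed causal almost everywhere. -/
structure IsCausalCurveOn (g : BilinField I M) (T : VecField I M) (γ : ℝ → M) (a b : ℝ) :
    Prop where
  lt : a < b
  continuousOn : ContinuousOn γ (Icc a b)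
  locallyLipschitz : ∀ s ∈ Icc a b, ∃ C, ∃ u ∈ 𝓝[Icc a b] s,
    LipschitzOnWith C (extChartAt I (γ s) ∘ γ) u
  futureCausal : ∀ᵐ s ∂(volume.restrict (Icc a b)),
    MDifferentiableAt 𝓘(ℝ, ℝ) I γ s ∧ FutureCausal I g T (γ s) (mfderiv 𝓘(ℝ, ℝ) I γ s (1 : ℝ))

/-- The causal future `J⁺(p)`. -/
def causalFuture (g : BilinField I M) (T : VecField I M) (p : M) : Set M :=
  {q | q = p ∨ ∃ (γ : ℝ → M) (a b : ℝ), IsCausalCurveOn I g T γ a b ∧ γ a = p ∧ γ b = q}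

/-- The causal past `J⁻(q)`. -/
def causalPast (g : BilinField I M) (T : VecField I M) (q : M) : Set M :=
  {p | q ∈ causalFuture I g T p}

/-- Strong causality: every neighborhood `U` of a point `p` contains a neighborhood `V` of `p` such
that causal curves with end points in `V` do not leave `U`. -/
def StronglyCausal (g : BilinField I M) (T : VecField I M) : Prop :=
  ∀ p : M, ∀ U ∈ 𝓝 p, ∃ V ∈ 𝓝 p, V ⊆ U ∧
    ∀ (γ : ℝ → M) (a b : ℝ), IsCausalCurveOn I g T γ a b → γ a ∈ V → γ b ∈ V →
      γ '' Icc a b ⊆ U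

/-- Global hyperbolicity: strong causality and compactness of all `J⁺(p) ∩ J⁻(q)`. -/
def GloballyHyperbolic (g : BilinField I M) (T : VecField I M) : Prop :=
  StronglyCausal I g T ∧ ∀ p q : M, IsCompact (causalFuture I g T p ∩ causalPast I g T q)

/-- A smooth (future directed) timelike curve `γ : ℝ → M` that is inextendible, i.e. has neither a
future nor a past end point in `M`. -/
structure IsInextendibleTimelikeCurve (g : BilinField I M) (T : VecField I M) (γ : ℝ → M) :
    Prop where
  contMDiff : ContMDiff 𝓘(ℝ, ℝ) I ∞ γ
  futureTimelike : ∀ s, FutureTimelike I g T (γ s) (mfderiv 𝓘(ℝ, ℝ) I γ s (1 : ℝ))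
  future_inextendible : ∀ p, ¬ Tendsto γ atTop (𝓝 p)
  past_inextendible : ∀ p, ¬ Tendsto γ atBot (𝓝 p)

end Spacetimes

section Ends

variable {E : Type*} [NormedAddCommGroup E] [NormedSpace ℝ E]
  {H : Type*} [TopologicalSpace H] (I : ModelWithCorners ℝ E H)
  {M : Type*} [TopologicalSpace M] [ChartedSpace H M]
  {E' : Type*} [NormedAddCommGroup E'] [NormedSpace ℝ E']
  {H' : Type*} [TopologicalSpace H'] (I' : ModelWithCorners ℝ E' H')
  {M' : Type*} [TopologicalSpace M'] [ChartedSpace H' M']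

/-- `(M', g', T')` together with the inclusion `j : M → M'`, the conformal factor `Ω : M' → ℝ` and
the curves `c i` (for the `k` indices `i : ℕ` with `i < k`) is a conformal extension of the
spacetime `(M, g, T)` exhibiting `k` asymptotically `AdS₂ × S^{n-1}` ends `𝒥ᵢ = range (c i)`.
We write `𝒥` for the union of the `𝒥ᵢ`. -/
structure IsEndExtension [IsManifold I ∞ M] [IsManifold I' ∞ M'] (n : ℕ) (k : ℕ∞)
    (g : BilinField I M) (T : VecField I M) (g' : BilinField I' M') (T' : VecField I' M')
    (j : M → M') (Ω : M' → ℝ) (c : {i : ℕ // (i : ℕ∞) < k} → ℝ → M') : Prop where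
  spacetime : IsSpacetime I' n g' T'
  lipschitz_metric : IsLipschitzMetric I' g'
  lipschitz_factor : IsLipschitzFunction I' Ω
  globallyHyperbolic : GloballyHyperbolic I' g' T'
  /- `j` is a diffeomorphism of `M` onto an open subset of `M'` and respects the time orientation. -/
  injective : Function.Injective j
  localDiffeomorph : IsLocalDiffeomorph I I' ∞ j
  timeOrientation : ∀ x, FutureTimelike I' g' T' (j x) (mfderiv I I' j x (T x))
  /- The boundary of `M` in `M'` is the disjoint union of the inextendible timelike curves. -/
  curves : ∀ i, IsInextendibleTimelikeCurve I' g' T' (c i)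
  disjoint : Pairwise fun i₁ i₂ => Disjoint (range (c i₁)) (range (c i₂))
  frontier_eq : frontier (range j) = ⋃ i, range (c i)
  factor_smooth : ContMDiff I 𝓘(ℝ, ℝ) ∞ (Ω ∘ j)
  factor_pos : ∀ x, 0 < Ω (j x)
  factor_zero : ∀ p ∈ ⋃ i, range (c i), Ω p = 0
  /- Each `p ∈ 𝒥` has a neighborhood `U` such that `U ∩ 𝒥` is connected and the components of `dΩ`,
  in coordinates around `p`, are bounded on `U \ 𝒥`. -/
  factor_differential_bounded : ∀ p ∈ ⋃ i, range (c i), ∃ U : Set M', IsOpen U ∧ p ∈ U ∧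
    U ⊆ (extChartAt I' p).source ∧ IsConnected (U ∩ ⋃ i, range (c i)) ∧
    ∃ C : ℝ, ∀ q ∈ U \ ⋃ i, range (c i),
      DifferentiableAt ℝ (Ω ∘ (extChartAt I' p).symm) (extChartAt I' p q) ∧
      ‖fderiv ℝ (Ω ∘ (extChartAt I' p).symm) (extChartAt I' p q)‖ ≤ C
  conformal : ∀ (x : M) (v w : TangentSpace I x),
    g' (j x) (mfderiv I I' j x v) (mfderiv I I' j x w) = Ω (j x) ^ 2 * g x v w

/-- `(M, g)`, time oriented by `T`, is a smooth spacetime of dimension `n + 1` with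
`k ∈ {1, 2, …, ∞}` asymptotically `AdS₂ × S^{n-1}` ends. -/
def HasAdS2Ends [IsManifold I ∞ M] (n : ℕ) (k : ℕ∞)
    (g : BilinField I M) (T : VecField I M) : Prop :=
  1 ≤ k ∧ IsSpacetime I n g T ∧ IsSmoothMetric I g ∧
    ∃ (E' : Type) (_ : NormedAddCommGroup E') (_ : NormedSpace ℝ E')
      (H' : Type) (_ : TopologicalSpace H') (I' : ModelWithCorners ℝ E' H')
      (M' : Type) (_ : TopologicalSpace M') (_ : ChartedSpace H' M') (_ : IsManifold I' ∞ M')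
      (g' : BilinField I' M') (T' : VecField I' M') (j : M → M') (Ω : M' → ℝ)
      (c : {i : ℕ // (i : ℕ∞) < k} → ℝ → M'),
      IsEndExtension I I' n k g T g' T' j Ω c

end Ends

section Examples

/-- The pullback under `φ : M → V` of the inner product of `V`: the form
`(v, w) ↦ ⟪dφ v, dφ w⟫`. For a real function `φ` this is `dφ²`. -/
def pullbackInner {E : Type*} [NormedAddCommGroup E] [NormedSpace ℝ E]
    {H : Type*} [TopologicalSpace H] (I : ModelWithCorners ℝ E H)
    {M : Type*} [TopologicalSpace M] [ChartedSpace H M]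
    {V : Type*} [NormedAddCommGroup V] [InnerProductSpace ℝ V] (φ : M → V) : BilinField I M :=
  fun x =>
    let dφ : E →L[ℝ] V := mfderiv I 𝓘(ℝ, V) φ x
    let b : E →L[ℝ] E →L[ℝ] ℝ := (innerSL ℝ : V →L[ℝ] V →L[ℝ] ℝ).bilinearComp dφ dφ
    b

/-- The unit sphere `S^m` in `ℝ^{m+1}`. -/
abbrev Sph (m : ℕ) : Type := Metric.sphere (0 : EuclideanSpace ℝ (Fin (m + 1))) 1

/-- The manifold `ℝ × ℝ × S^m`, with points `(t, r, ω)`. -/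
abbrev Spc (m : ℕ) : Type := ℝ × ℝ × Sph m

/-- The model with corners (without boundary) of `ℝ × ℝ × S^m`. -/
abbrev SpcModel (m : ℕ) :
    ModelWithCorners ℝ (ℝ × ℝ × EuclideanSpace ℝ (Fin m))
      (ModelProd ℝ (ModelProd ℝ (EuclideanSpace ℝ (Fin m)))) :=
  𝓘(ℝ, ℝ).prod (𝓘(ℝ, ℝ).prod (𝓡 m))

/-- The metric `-f(r) dt² + f(r)⁻¹ dr² + dω²` on `ℝ × ℝ × S^m`, where `dω²` is the round metric, i.e.
the one induced by the inclusion of the unit sphere `S^m` in `ℝ^{m+1}`. -/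
def staticMetric (m : ℕ) (f : ℝ → ℝ) : BilinField (SpcModel m) (Spc m) := fun p =>
  -(f p.2.1 • pullbackInner (SpcModel m) (fun q : Spc m => q.1) p)
    + (f p.2.1)⁻¹ • pullbackInner (SpcModel m) (fun q : Spc m => q.2.1) p
    + pullbackInner (SpcModel m)
        (fun q : Spc m => (q.2.2 : EuclideanSpace ℝ (Fin (m + 1)))) p

/-- The coordinate vector field `∂_t` on `ℝ × ℝ × S^m`. -/
def timeField (m : ℕ) : VecField (SpcModel m) (Spc m) := fun p =>
  mfderiv 𝓘(ℝ, ℝ) (SpcModel m) (fun s : ℝ => ((s, p.2) : Spc m)) p.1 (1 : ℝ)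

/-- The scale factor `a(x) = √(F(x)) sin² x`, where `F(x) = f(r(x))` and
`r(x) = -tan(x - π/2)`. -/
def scaleFactor (f : ℝ → ℝ) (x : ℝ) : ℝ :=
  Real.sqrt (f (-Real.tan (x - Real.pi / 2))) * Real.sin x ^ 2

end Examples

end AdSEnds

end

namespace AdSEnds

/-! Part (b) rests on Mercator's conformal map. Let `ρ` solve dρ = dr/√f. Then cosh(ρ)⁻² g = -w² dt²
+ cosh(ρ)⁻² (dρ² + dω²) with w = √f / cosh ρ, and the second term is the round metric of S^n minus
its two poles, written on the cylinder with (tanh ρ, θ / cosh ρ) as the point of the sphere. So the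
extension is ℝ × S^n with the metric -w² dt² + round metric, the factor Ω = 1 / cosh ρ is the
distance to the polar axis, and the ends are the two lines over the poles. It remains to extend w
over the poles as a positive Lipschitz function and to prove global hyperbolicity.

For the model f = 1 + r² one has ρ = arsinh r and w = 1. In general, f - (1 + r²) = O(√(1 + r²))
makes 1/√f - 1/√(1 + r²) integrable, so ρ stays within bounded distance of arsinh r and w lies
between positive constants. In terms of the latitude Θ = arctan(sinh ρ) one finds dw/dΘ = f'/2 - √f
tanh ρ, which is bounded because f' = 2r + O(1), √f = √(1 + r²) + O(1) and √(1 + r²) tanh ρ = r +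
O(1). This is `exists_radialCoordinate`; `conformal_cylinderEmbedding` is the conformal identity.

Global hyperbolicity (`globallyHyperbolic_warpedMetric`) holds for every bounded positive Lipschitz
w. Causal curves are, after parametrization by t, the curves in the sphere of speed at most w.
Written as a family of inequalities between pairs of values, this condition is closed under
pointwise limits, so Tychonoff's theorem gives compact families of curves, hence compact causal
diamonds.

Part (a) (`scaleFactor_asymptotics`) is independent of this: r = cot x, and everything follows from
√f(r) - r = O(1). -/

/-! ### Growth estimates, the radial coordinate and the Lipschitz extension of the lapse -/

theorem exists_forall_abs_le_mul_of_isBigO {h k : ℝ → ℝ} (hh : Continuous h) (hk : Continuous k)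
    (hk0 : ∀ r, 0 < k r) (ht : h =O[atTop] k) (hb : h =O[atBot] k) :
    ∃ C, 0 < C ∧ ∀ r, |h r| ≤ C * k r := by
  have hc : h =O[cocompact ℝ] k := by
    rw [cocompact_eq_atBot_atTop]
    exact hb.sup ht
  obtain ⟨C₁, hC₁, h₁⟩ := hc.exists_pos
  obtain ⟨s, hs, hsub⟩ := mem_cocompact.1 h₁.bound
  obtain ⟨C₂, h₂⟩ := hs.exists_bound_of_continuousOn (f := fun r => h r / k r)
    (hh.div hk fun r => (hk0 r).ne').continuousOn
  refine ⟨max C₁ C₂, lt_max_of_lt_left hC₁, fun r => ?_⟩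
  by_cases hr : r ∈ s
  · have := h₂ r hr
    rw [Real.norm_eq_abs, abs_div, abs_of_pos (hk0 r), div_le_iff₀ (hk0 r)] at this
    exact this.trans (by gcongr; · exact (hk0 r).le
                         · exact le_max_right _ _)
  · have : ‖h r‖ ≤ C₁ * ‖k r‖ := hsub hr
    rw [Real.norm_eq_abs, Real.norm_eq_abs, abs_of_pos (hk0 r)] at this
    exact this.trans (by gcongr; · exact (hk0 r).le
                         · exact le_max_left _ _)

theorem one_add_sq_isBigO_of_sub_sq_isBigO {f : ℝ → ℝ} {l : Filter ℝ}
    (hl : Tendsto (fun r : ℝ => |r|) l atTop)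
    (hf : (fun r => f r - r ^ 2) =O[l] fun r => r) :
    (fun r => 1 + r ^ 2) =O[l] f := by
  obtain ⟨C, hC, hb⟩ := hf.exists_pos
  -- For |r| ≥ max(4C, 1) the error C|r| is at most r²/4, so 4 f ≥ 3 r² ≥ 1 + r².
  refine IsBigO.of_bound 4 ?_
  filter_upwards [hb.bound, hl.eventually_ge_atTop (4 * C), hl.eventually_ge_atTop 1]
    with r h1 h2 h3
  rw [Real.norm_eq_abs, Real.norm_eq_abs] at *
  have h4 : C * |r| ≤ r ^ 2 / 4 := by
    rw [← sq_abs r]; nlinarith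
  have h5 : 1 ≤ r ^ 2 := by rw [← sq_abs r]; nlinarith
  have h6 := (abs_le.1 h1).1
  rw [abs_of_pos (by positivity)]
  have := le_abs_self (f r)
  linarith

theorem cosh_le_exp_abs_sub_mul_cosh (x y : ℝ) :
    Real.cosh x ≤ Real.exp |x - y| * Real.cosh y := by
  have h1 : Real.exp x ≤ Real.exp |x - y| * Real.exp y := by
    rw [← Real.exp_add]; gcongr; linarith [le_abs_self (x - y)]
  have h2 : Real.exp (-x) ≤ Real.exp |x - y| * Real.exp (-y) := by
    rw [← Real.exp_add]; gcongr; linarith [neg_abs_le (x - y)]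
  rw [Real.cosh_eq, Real.cosh_eq]
  linarith

theorem abs_sinh_le_exp_abs (x : ℝ) : |Real.sinh x| ≤ Real.exp |x| := by
  rw [Real.abs_sinh, Real.sinh_eq]
  have := Real.exp_pos (-|x|)
  have := Real.exp_pos (|x|)
  linarith

/-- Both Θ - h and Θ + h are nondecreasing. With Θ a multiple of arctan this bounds ρ - arsinh; with
Θ a multiple of the latitude it gives the Lipschitz estimate for the lapse. -/
theorem abs_sub_le_sub_of_hasDerivAt {h Θ h' Θ' : ℝ → ℝ} (hh : ∀ r, HasDerivAt h (h' r) r)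
    (hΘ : ∀ r, HasDerivAt Θ (Θ' r) r) (hle : ∀ r, |h' r| ≤ Θ' r) {a b : ℝ} (hab : a ≤ b) :
    |h b - h a| ≤ Θ b - Θ a := by
  have h1 : Monotone (Θ - h) := monotone_of_hasDerivAt_nonneg
    (fun r => (hΘ r).sub (hh r)) fun r => sub_nonneg.2 ((le_abs_self _).trans (hle r))
  have h2 : Monotone (Θ + h) := monotone_of_hasDerivAt_nonneg
    (fun r => (hΘ r).add (hh r)) fun r => by
      have := (neg_abs_le (h' r)).trans' (neg_le_neg (hle r))
      simp only [Pi.zero_apply]; linarith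
  have h3 := h1 hab
  have h4 := h2 hab
  simp only [Pi.sub_apply, Pi.add_apply] at h3 h4
  rw [abs_le]; constructor <;> linarith

/-- A Lipschitz estimate of `k` in terms of an injective function `Θ` yields a globally defined
Lipschitz function `W` with `W ∘ Θ = k`, obeying the bounds of `k`. -/
theorem exists_lipschitzWith_comp_eq {k Θ : ℝ → ℝ} {M c C : ℝ} (hc : c ≤ C)
    (hk : ∀ r, k r ∈ Icc c C) (hM : 0 ≤ M) (h : ∀ a b, |k b - k a| ≤ M * |Θ b - Θ a|) :
    ∃ (W : ℝ → ℝ) (K : NNReal), LipschitzWith K W ∧ (∀ x, W x ∈ Icc c C) ∧ ∀ r, W (Θ r) = k r := by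
  -- The estimate itself makes `k` constant on the fibres of `Θ`, so any choice of preimages will
  -- do.
  have hinv : ∀ r, k (Function.invFun Θ (Θ r)) = k r := fun r => by
    have h1 : Θ (Function.invFun Θ (Θ r)) = Θ r := Function.invFun_eq ⟨r, rfl⟩
    have h2 := h r (Function.invFun Θ (Θ r))
    rw [h1, sub_self, abs_zero, mul_zero] at h2
    exact sub_eq_zero.1 (abs_nonpos_iff.1 h2)
  have hL : LipschitzOnWith M.toNNReal (k ∘ Function.invFun Θ) (range Θ) := by
    refine LipschitzOnWith.of_dist_le_mul ?_
    rintro _ ⟨a, rfl⟩ _ ⟨b, rfl⟩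
    simp only [Function.comp_apply, hinv, Real.dist_eq, Real.coe_toNNReal _ hM]
    exact h b a
  obtain ⟨g, hg, hgk⟩ := hL.extend_real
  -- Truncating the extension to [c, C] keeps it Lipschitz and changes nothing on the range of `Θ`.
  refine ⟨fun x => max c (min C (g x)), _, (hg.const_min C).const_max c,
    fun x => ⟨le_max_left _ _, max_le hc (min_le_left _ _)⟩, fun r => ?_⟩
  have : g (Θ r) = k r := by
    rw [← hgk ⟨r, rfl⟩, Function.comp_apply, hinv]
  simp only [this, min_eq_right (hk r).2, max_eq_right (hk r).1]

/-- The radial coordinate `ρ` with `dρ = dr / √f` and the Lipschitz function `W` extending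
`√f / cosh ρ` as a function of the Gudermannian `arctan (sinh ρ)`. -/
theorem exists_radialCoordinate {f : ℝ → ℝ} (hf : ContDiff ℝ ∞ f) (hpos : ∀ r, 0 < f r)
    (ht : (fun r => f r - r ^ 2) =O[atTop] (fun r => r))
    (ht' : (fun r => deriv f r - 2 * r) =O[atTop] (fun _ => (1 : ℝ)))
    (hb : (fun r => f r - r ^ 2) =O[atBot] (fun r => r))
    (hb' : (fun r => deriv f r - 2 * r) =O[atBot] (fun _ => (1 : ℝ))) :
    ∃ ρ : ℝ → ℝ, ContDiff ℝ ∞ ρ ∧ (∀ r, HasDerivAt ρ (√(f r))⁻¹ r) ∧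
      Tendsto ρ atTop atTop ∧ Tendsto ρ atBot atBot ∧
      ∃ (W : ℝ → ℝ) (K : NNReal) (c C : ℝ), 0 < c ∧ LipschitzWith K W ∧
        (∀ x, W x ∈ Icc c C) ∧ ∀ r, W (Real.arctan (Real.sinh (ρ r))) = √(f r) / Real.cosh (ρ r) := by
  have hfc : Continuous f := hf.continuous
  have hsp : ∀ r, 0 < √(f r) := fun r => Real.sqrt_pos.2 (hpos r)
  have hss : ∀ r, √(f r) ^ 2 = f r := fun r => Real.sq_sqrt (hpos r).le
  -- `q` is √f for the model f = 1 + r², and q = cosh(arsinh r).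
  set q : ℝ → ℝ := fun r => √(1 + r ^ 2) with hq
  have hqp : ∀ r, 0 < q r := fun r => Real.sqrt_pos.2 (by positivity)
  have hqs : ∀ r, q r ^ 2 = 1 + r ^ 2 := fun r => Real.sq_sqrt (by positivity)
  have hq1 : ∀ r, 1 ≤ q r := fun r => by nlinarith [hqs r, hqp r, sq_nonneg r]
  have hqr : ∀ r, |r| ≤ q r := fun r => Real.abs_le_sqrt (by linarith)
  have hqc : Continuous q := by fun_prop
  have hrq : ∀ l : Filter ℝ, (fun r : ℝ => r) =O[l] q := fun l =>
    IsBigO.of_bound 1 (Eventually.of_forall fun r => by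
      simpa [abs_of_pos (hqp r)] using hqr r)
  have h1q : ∀ l : Filter ℝ, (fun _ : ℝ => (1:ℝ)) =O[l] q := fun l =>
    IsBigO.of_bound 1 (Eventually.of_forall fun r => by
      simpa [abs_of_pos (hqp r)] using hq1 r)
  obtain ⟨A, hA, hA'⟩ := exists_forall_abs_le_mul_of_isBigO (h := fun r => (f r - r ^ 2) - 1)
    (k := q) (by fun_prop) hqc hqp ((ht.trans (hrq _)).sub (h1q _)) ((hb.trans (hrq _)).sub (h1q _))
  obtain ⟨B, hB, hB'⟩ := exists_forall_abs_le_mul_of_isBigO (h := fun r => 1 + r ^ 2)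
    (k := f) (by fun_prop) hfc hpos
    (one_add_sq_isBigO_of_sub_sq_isBigO tendsto_abs_atTop_atTop ht)
    (one_add_sq_isBigO_of_sub_sq_isBigO tendsto_abs_atBot_atTop hb)
  have hfd : ∀ r, HasDerivAt f (deriv f r) r := fun r =>
    (hf.differentiable (by simp) r).hasDerivAt
  obtain ⟨D, hD, hD'⟩ := exists_forall_abs_le_mul_of_isBigO (h := fun r => deriv f r - 2 * r)
    (k := fun _ => 1) ((hf.continuous_deriv (by simp)).sub (by fun_prop)) continuous_const
    (fun _ => one_pos) ht' hb'
  -- comparison of `√f` and `q`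
  have hsq : ∀ r, |√(f r) - q r| ≤ A := fun r => by
    have h1 := hA' r
    have h2 : f r - r ^ 2 - 1 = (√(f r) - q r) * (√(f r) + q r) := by
      linear_combination -(hss r) + hqs r
    rw [h2, abs_mul, abs_of_pos (add_pos (hsp r) (hqp r))] at h1
    have h3 : |√(f r) - q r| * q r ≤ A * q r :=
      (mul_le_mul_of_nonneg_left (by linarith [hsp r]) (abs_nonneg _)).trans h1
    exact le_of_mul_le_mul_right h3 (hqp r)
  have hqB : ∀ r, q r ≤ √B * √(f r) := fun r => by
    rw [← Real.sqrt_mul hB.le]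
    exact Real.sqrt_le_sqrt ((le_abs_self _).trans (hB' r))
  have hBp : 0 < √B := Real.sqrt_pos.2 hB
  -- the radial coordinate
  have hic : Continuous fun r => (√(f r))⁻¹ := (by fun_prop : Continuous fun r => √(f r)).inv₀
    fun r => (hsp r).ne'
  set ρ : ℝ → ℝ := fun r => ∫ x in (0 : ℝ)..r, (√(f x))⁻¹ with hρ
  have hρd : ∀ r, HasDerivAt ρ (√(f r))⁻¹ r := fun r => hic.integral_hasStrictDerivAt 0 r |>.hasDerivAt
  have hρs : ContDiff ℝ ∞ ρ := by
    rw [contDiff_infty_iff_deriv]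
    refine ⟨fun r => (hρd r).differentiableAt, ?_⟩
    rw [funext fun r => (hρd r).deriv]
    exact (hf.sqrt fun r => (hpos r).ne').inv fun r => (hsp r).ne'
  have hρ0 : ρ 0 = 0 := by simp [hρ]
  -- The difference is |√f - q| / (√f q), with numerator at most A and q ≤ √B √f. The resulting
  -- bound is the derivative of a multiple of arctan, whose total variation is finite.
  have hd1 : ∀ r, |(√(f r))⁻¹ - (q r)⁻¹| ≤ A * √B * (1 / (1 + r ^ 2)) := fun r => by
    rw [inv_sub_inv (hsp r).ne' (hqp r).ne', abs_div, abs_sub_comm,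
      abs_of_pos (mul_pos (hsp r) (hqp r)), ← hqs r, mul_one_div,
      div_le_div_iff₀ (mul_pos (hsp r) (hqp r)) (pow_pos (hqp r) 2)]
    have h1 := hsq r
    have h2 := hqB r
    have h3 := hqp r
    calc |√(f r) - q r| * q r ^ 2 ≤ A * (q r * q r) := by rw [sq]; gcongr
      _ ≤ A * (√B * √(f r) * q r) := by gcongr
      _ = _ := by ring
  have hdist : ∀ r, |ρ r - Real.arsinh r| ≤ A * √B * (Real.pi / 2) := fun r => by
    have key : ∀ a b : ℝ, a ≤ b → _ := fun a b hab => abs_sub_le_sub_of_hasDerivAt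
      (h := fun r => ρ r - Real.arsinh r) (fun r => (hρd r).sub (Real.hasDerivAt_arsinh r))
      (fun r => (Real.hasDerivAt_arctan r).const_mul (A * √B)) hd1 hab
    have hAB : 0 < A * √B := by positivity
    rcases le_total 0 r with h | h
    · have := key 0 r h
      simp only [hρ0, Real.arsinh_zero, sub_zero, Real.arctan_zero, mul_zero] at this
      refine this.trans ?_
      gcongr
      exact (Real.arctan_lt_pi_div_two r).le
    · have := key r 0 h
      simp only [hρ0, Real.arsinh_zero, sub_zero, Real.arctan_zero, mul_zero, zero_sub, abs_neg] at this
      refine this.trans ?_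
      rw [← mul_neg]
      gcongr
      linarith [Real.neg_pi_div_two_lt_arctan r]
  set L := A * √B * (Real.pi / 2) with hL
  have har : ∀ r, Real.cosh (Real.arsinh r) = q r := fun r => Real.cosh_arsinh r
  have hcp : ∀ r, 0 < Real.cosh (ρ r) := fun r => Real.cosh_pos _
  have hc1 : ∀ r, Real.cosh (ρ r) ≤ Real.exp L * q r := fun r => by
    rw [← har]
    refine (cosh_le_exp_abs_sub_mul_cosh _ (Real.arsinh r)).trans ?_
    gcongr
    exact hdist r
  have hc2 : ∀ r, q r ≤ Real.exp L * Real.cosh (ρ r) := fun r => by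
    rw [← har]
    refine (cosh_le_exp_abs_sub_mul_cosh _ (ρ r)).trans ?_
    rw [abs_sub_comm]
    gcongr
    exact hdist r
  have harT : Tendsto Real.arsinh atTop atTop := Real.sinhOrderIso.symm.tendsto_atTop
  have harB : Tendsto Real.arsinh atBot atBot := Real.sinhOrderIso.symm.tendsto_atBot
  refine ⟨ρ, hρs, hρd, ?_, ?_, ?_⟩
  · refine tendsto_atTop_mono (fun r => ?_) (tendsto_atTop_add_const_right _ (-L) harT)
    have := (abs_le.1 (hdist r)).1
    linarith
  · refine tendsto_atBot_mono (fun r => ?_) (tendsto_atBot_add_const_right _ L harB)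
    have := (abs_le.1 (hdist r)).2
    linarith
  -- The three terms bound the parts of (f'/2 - r) - (√f - q) tanh ρ - (q tanh ρ - r), in this
  -- order.
  set M := D / 2 + A + Real.exp L with hM
  have hMp : 0 < M := by positivity
  have hΘd : ∀ r, HasDerivAt (fun r => Real.arctan (Real.sinh (ρ r)))
      ((√(f r))⁻¹ * (Real.cosh (ρ r))⁻¹) r := fun r => by
    have := ((hρd r).sinh).arctan
    convert this using 1
    rw [← Real.cosh_sq']
    field_simp [(hcp r).ne', (hsp r).ne']
  -- The derivative is written as a factor times Θ', so that the factor is the derivative with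
  -- respect to the latitude Θ.
  have hkd : ∀ r, HasDerivAt (fun r => √(f r) / Real.cosh (ρ r))
      ((deriv f r / 2 - √(f r) * Real.tanh (ρ r)) * ((√(f r))⁻¹ * (Real.cosh (ρ r))⁻¹)) r :=
    fun r => by
    have := ((hfd r).sqrt (hpos r).ne').div ((hρd r).cosh) (hcp r).ne'
    refine this.congr_deriv ?_
    rw [Real.tanh_eq_sinh_div_cosh]
    have := (hcp r).ne'
    have := (hsp r).ne'
    field_simp
  have hbd : ∀ r, |deriv f r / 2 - √(f r) * Real.tanh (ρ r)| ≤ M := fun r => by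
    -- Since q and r are cosh and sinh of arsinh r, this is the subtraction formula for sinh.
    have e1 : q r * Real.tanh (ρ r) - r = Real.sinh (ρ r - Real.arsinh r) / Real.cosh (ρ r) := by
      rw [Real.sinh_sub, har, Real.sinh_arsinh, Real.tanh_eq_sinh_div_cosh]
      have := (hcp r).ne'
      field_simp
    have e2 : |q r * Real.tanh (ρ r) - r| ≤ Real.exp L := by
      rw [e1, abs_div, abs_of_pos (hcp r)]
      refine (div_le_self (abs_nonneg _) (Real.one_le_cosh _)).trans ?_
      exact (abs_sinh_le_exp_abs _).trans (Real.exp_le_exp.2 (hdist r))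
    have e3 : |(√(f r) - q r) * Real.tanh (ρ r)| ≤ A := by
      rw [abs_mul]
      calc _ ≤ A * 1 := by
            gcongr
            · exact hsq r
            · exact (Real.abs_tanh_lt_one _).le
        _ = A := mul_one _
    have e4 := hD' r
    rw [mul_one] at e4
    rw [abs_le] at e2 e3 e4 ⊢
    constructor <;> nlinarith
  have hlip : ∀ a b, |√(f b) / Real.cosh (ρ b) - √(f a) / Real.cosh (ρ a)|
      ≤ M * |Real.arctan (Real.sinh (ρ b)) - Real.arctan (Real.sinh (ρ a))| := by
    have key : ∀ a b : ℝ, a ≤ b → _ := fun a b hab => abs_sub_le_sub_of_hasDerivAt hkd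
      (fun r => (hΘd r).const_mul M) (fun r => by
        rw [abs_mul, abs_of_pos (mul_pos (inv_pos.2 (hsp r)) (inv_pos.2 (hcp r)))]
        exact mul_le_mul_of_nonneg_right (hbd r)
          (mul_pos (inv_pos.2 (hsp r)) (inv_pos.2 (hcp r))).le) hab
    intro a b
    rcases le_total a b with h | h
    · refine (key a b h).trans ?_
      rw [← mul_sub]
      gcongr
      exact le_abs_self _
    · rw [abs_sub_comm, abs_sub_comm (Real.arctan _)]
      refine (key b a h).trans ?_
      rw [← mul_sub]
      gcongr
      exact le_abs_self _
  have hk : ∀ r, √(f r) / Real.cosh (ρ r) ∈ Icc ((√B * Real.exp L)⁻¹) ((1 + A) * Real.exp L) :=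
    fun r => by
    constructor
    · rw [le_div_iff₀ (hcp r), inv_mul_le_iff₀ (by positivity)]
      calc _ ≤ Real.exp L * q r := hc1 r
        _ ≤ Real.exp L * (√B * √(f r)) := by gcongr; exact hqB r
        _ = _ := by ring
    · rw [div_le_iff₀ (hcp r)]
      have h1 := (abs_le.1 (hsq r)).2
      have h2 := hq1 r
      calc √(f r) ≤ (1 + A) * q r := by nlinarith
        _ ≤ (1 + A) * (Real.exp L * Real.cosh (ρ r)) := by gcongr; exact hc2 r
        _ = _ := by ring
  obtain ⟨W, K, hW, hWb, hWk⟩ := exists_lipschitzWith_comp_eq ((hk 0).1.trans (hk 0).2) hk hMp.le hlip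
  exact ⟨W, K, _, _, by positivity, hW, hWb, hWk⟩

/-! ### Asymptotics of the scale factor -/

theorem neg_tan_sub_pi_div_two (x : ℝ) : -Real.tan (x - Real.pi / 2) = Real.cos x / Real.sin x := by
  rw [Real.tan_eq_sin_div_cos, Real.sin_sub_pi_div_two, Real.cos_sub_pi_div_two, neg_div, neg_neg]

theorem tendsto_cos_div_sin_nhdsGT_zero :
    Tendsto (fun x => Real.cos x / Real.sin x) (𝓝[>] 0) atTop := by
  have h1 : Tendsto Real.cos (𝓝[>] 0) (𝓝 1) := by
    simpa using (Real.continuous_cos.tendsto 0).mono_left nhdsWithin_le_nhds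
  have h2 : Tendsto Real.sin (𝓝[>] 0) (𝓝[>] 0) := by
    refine tendsto_nhdsWithin_iff.2 ⟨?_, ?_⟩
    · simpa using (Real.continuous_sin.tendsto 0).mono_left nhdsWithin_le_nhds
    · filter_upwards [Ioo_mem_nhdsGT Real.pi_pos] with x hx using Real.sin_pos_of_mem_Ioo hx
  simp only [div_eq_mul_inv]
  exact h1.pos_mul_atTop one_pos h2.inv_tendsto_nhdsGT_zero

/-- Put s = sin x, c = cos x, r = c/s, q = √f(r). From q - r = O(1) and rs = c one gets a = cs + (q
- r)s². In the derivative a' = -f'/(2q) + 2qsc the leading parts are -1 and 2c² = 2 - 2s²; the O(1)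
errors come multiplied by 1/(2q) or 2sc, both O(x). -/
theorem scaleFactor_asymptotics {f : ℝ → ℝ} {r₀ : ℝ} (hf : ContDiffOn ℝ ∞ f (Ioi r₀))
    (hpos : ∀ r ∈ Ioi r₀, 0 < f r)
    (ho : (fun r => f r - r ^ 2) =O[atTop] (fun r => r))
    (ho' : (fun r => deriv f r - 2 * r) =O[atTop] (fun _ => (1 : ℝ))) :
    (fun x => scaleFactor f x - x) =O[𝓝[>] 0] (fun x => x ^ 2) ∧
      (∀ᶠ x in 𝓝[>] 0, DifferentiableAt ℝ (scaleFactor f) x) ∧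
      (fun x => deriv (scaleFactor f) x - 1) =O[𝓝[>] 0] (fun x => x) := by
  obtain ⟨A, hA, hA'⟩ := ho.exists_pos
  obtain ⟨D, hD, hD'⟩ := ho'.exists_pos
  have hr : ∀ᶠ r in atTop, r₀ < r ∧ 2 * A ≤ r ∧ 0 < r ∧ |f r - r ^ 2| ≤ A * r ∧
      |deriv f r - 2 * r| ≤ D := by
    filter_upwards [eventually_gt_atTop r₀, eventually_ge_atTop (2 * A), eventually_gt_atTop 0,
      hA'.bound, hD'.bound] with r h1 h2 h3 h4 h5
    refine ⟨h1, h2, h3, ?_, ?_⟩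
    · simpa [abs_of_pos h3] using h4
    · simpa using h5
  have hsf : scaleFactor f = fun x => √(f (Real.cos x / Real.sin x)) * Real.sin x ^ 2 := by
    funext x
    rw [scaleFactor, neg_tan_sub_pi_div_two]
  have key : ∀ᶠ x in 𝓝[>] (0 : ℝ), |scaleFactor f x - x| ≤ (A + 1) * x ^ 2 ∧
      DifferentiableAt ℝ (scaleFactor f) x ∧
      -- The constant collects 2(D + 2A) from the f' term, 2A from (q - r)·2sc, and 2 from 2s².
      |deriv (scaleFactor f) x - 1| ≤ (6 * A + 2 * D + 2) * x := by
    filter_upwards [tendsto_cos_div_sin_nhdsGT_zero.eventually hr, Ioo_mem_nhdsGT one_pos] with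
      x ⟨h1, h2, h3, h4, h5⟩ ⟨hx0, hx1⟩
    have hs0 : 0 < Real.sin x :=
      Real.sin_pos_of_pos_of_lt_pi hx0 (by linarith [Real.pi_gt_three])
    have hsx : Real.sin x ≤ x := Real.sin_le hx0.le
    have hsx' : x - x ^ 3 / 6 < Real.sin x := Real.sin_gt_sub_cube hx0
    have hc1 : Real.cos x ≤ 1 := Real.cos_le_one x
    have hcx : 1 - x ^ 2 / 2 ≤ Real.cos x := Real.one_sub_sq_div_two_le_cos
    have hc0 : 1 / 2 ≤ Real.cos x := by nlinarith
    have hsc := Real.sin_sq_add_cos_sq x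
    set s := Real.sin x with hs
    set c := Real.cos x with hc
    set r := c / s with hrdef
    have hrs : r * s = c := div_mul_cancel₀ _ hs0.ne'
    have hfp : 0 < f r := hpos r h1
    have hq : 0 < √(f r) := Real.sqrt_pos.2 hfp
    have hqq : √(f r) ^ 2 = f r := Real.sq_sqrt hfp.le
    -- Divide |f - r²| ≤ A r by √f + r ≥ r.
    have hqr : |√(f r) - r| ≤ A := by
      rw [show f r - r ^ 2 = (√(f r) - r) * (√(f r) + r) by linear_combination -hqq, abs_mul,
        abs_of_pos (add_pos hq h3)] at h4
      refine le_of_mul_le_mul_right ?_ h3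
      refine (mul_le_mul_of_nonneg_left ?_ (abs_nonneg _)).trans h4
      linarith
    set q := √(f r) with hqdef
    obtain ⟨hq1, hq2⟩ := abs_le.1 hqr
    have hfd : HasDerivAt f (deriv f r) r :=
      ((hf.contDiffAt (Ioi_mem_nhds h1)).differentiableAt (by simp)).hasDerivAt
    have hrd : HasDerivAt (fun x => Real.cos x / Real.sin x) (-1 / s ^ 2) x := by
      refine ((Real.hasDerivAt_cos x).div (Real.hasDerivAt_sin x) hs0.ne').congr_deriv ?_
      rw [← hs, ← hc]
      congr 1
      linear_combination -hsc
    have had : HasDerivAt (scaleFactor f) (-(deriv f r / (2 * q)) + 2 * q * s * c) x := by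
      rw [hsf]
      refine (((hfd.comp x hrd).sqrt hfp.ne').mul ((Real.hasDerivAt_sin x).pow 2)).congr_deriv ?_
      simp only [Function.comp_apply, Pi.pow_apply, ← hs, ← hc, ← hrdef, ← hqdef]
      field_simp
      ring
    refine ⟨?_, had.differentiableAt, ?_⟩
    · have e : scaleFactor f x - x = (q - r) * s ^ 2 + (c * s - x) := by
        rw [hsf]; simp only [← hs, ← hc, ← hrdef, ← hqdef]
        linear_combination s * hrs
      have e1 : |(q - r) * s ^ 2| ≤ A * x ^ 2 := by
        rw [abs_mul, abs_of_pos (pow_pos hs0 2)]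
        gcongr
      have e2 : |c * s - x| ≤ 1 * x ^ 2 := by
        rw [abs_le]
        constructor
        · nlinarith [mul_le_mul hcx hsx'.le (by nlinarith) (by linarith), pow_pos hx0 3,
            pow_pos hx0 2, pow_pos hx0 5]
        · nlinarith
      rw [e, add_mul]
      exact (abs_add_le _ _).trans (add_le_add e1 e2)
    · rw [had.deriv]
      have e : -(deriv f r / (2 * q)) + 2 * q * s * c - 1
          = -((deriv f r - 2 * q) / (2 * q)) + (q - r) * (2 * s * c) - 2 * s ^ 2 := by
        rw [sub_div, div_self (by positivity)]
        linear_combination 2 * c * hrs + 2 * hsc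
      -- From r ≥ 2A and q ≥ r - A follows r ≤ 2q. With c ≥ 1/2 this yields 1 ≤ 4qs ≤ 4qx, that is
      -- 1/(2q) ≤ 2x.
      have hq3 : c ≤ 2 * q * s := by
        have : r ≤ 2 * q := by linarith
        calc c = r * s := hrs.symm
          _ ≤ _ := by gcongr
      have e1 : |(deriv f r - 2 * q) / (2 * q)| ≤ (D + 2 * A) * (2 * x) := by
        rw [abs_div, abs_of_pos (show 0 < 2 * q by positivity), div_le_iff₀ (by positivity)]
        have : |deriv f r - 2 * q| ≤ D + 2 * A := by
          rw [abs_le] at h5 ⊢; constructor <;> linarith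
        refine this.trans ?_
        have h6 : q * s ≤ q * x := by gcongr
        calc D + 2 * A = (D + 2 * A) * 1 := (mul_one _).symm
          _ ≤ (D + 2 * A) * (4 * (q * x)) := by gcongr; linarith
          _ = _ := by ring
      have e2 : |(q - r) * (2 * s * c)| ≤ A * (2 * x) := by
        rw [abs_mul, abs_of_pos (show 0 < 2 * s * c by positivity)]
        have : 2 * s * c ≤ 2 * x := by
          linarith [mul_le_mul hsx hc1 (by linarith) hx0.le]
        gcongr
      have e3 : 2 * s ^ 2 ≤ 2 * x := by
        linarith [mul_le_mul hsx (hsx.trans hx1.le) hs0.le hx0.le, sq s]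
      rw [e]
      have e4 : 0 ≤ 2 * s ^ 2 := by positivity
      rw [abs_le] at e1 e2 ⊢
      constructor <;> linarith
  refine ⟨IsBigO.of_bound (A + 1) ?_, key.mono fun x h => h.2.1,
    IsBigO.of_bound (6 * A + 2 * D + 2) ?_⟩
  · filter_upwards [key] with x h
    simpa using h.1
  · filter_upwards [key, self_mem_nhdsWithin] with x h hx
    simpa [abs_of_pos (show (0:ℝ) < x from hx)] using h.2.2

/-! ### Calculus of locally Lipschitz maps -/

section LocallyLipschitz

theorem _root_.LocallyLipschitz.comp_locallyLipschitzOn {α β γ : Type*} [PseudoEMetricSpace α]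
    [PseudoEMetricSpace β] [PseudoEMetricSpace γ] {g : β → γ} {f : α → β} {s : Set α}
    (hg : LocallyLipschitz g) (hf : LocallyLipschitzOn s f) : LocallyLipschitzOn s (g ∘ f) := by
  intro x hx
  obtain ⟨K, t, ht, hK⟩ := hg (f x)
  obtain ⟨K', t', ht', hK'⟩ := hf hx
  exact ⟨K * K', t' ∩ f ⁻¹' t, inter_mem ht' (hf.continuousOn x hx ht),
    hK.comp (hK'.mono inter_subset_left) fun _ h => h.2⟩

theorem _root_.LocallyLipschitzOn.prodMk {α β γ : Type*} [PseudoEMetricSpace α]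
    [PseudoEMetricSpace β] [PseudoEMetricSpace γ] {f : α → β} {g : α → γ} {s : Set α}
    (hf : LocallyLipschitzOn s f) (hg : LocallyLipschitzOn s g) :
    LocallyLipschitzOn s fun x => (f x, g x) := by
  intro x hx
  obtain ⟨K, t, ht, hK⟩ := hf hx
  obtain ⟨K', t', ht', hK'⟩ := hg hx
  exact ⟨max K K', t ∩ t', inter_mem ht ht',
    (hK.mono inter_subset_left).prodMk (hK'.mono inter_subset_right)⟩

theorem _root_.ContDiffOn.locallyLipschitzOn_of_isOpen {E F : Type*} [NormedAddCommGroup E]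
    [NormedSpace ℝ E] [NormedAddCommGroup F] [NormedSpace ℝ F] {f : E → F} {s : Set E}
    (hf : ContDiffOn ℝ 1 f s) (hs : IsOpen s) : LocallyLipschitzOn s f := by
  intro x hx
  obtain ⟨K, t, ht, hK⟩ := (hf.contDiffAt (hs.mem_nhds hx)).exists_lipschitzOnWith
  exact ⟨K, t, mem_nhdsWithin_of_mem_nhds ht, hK⟩

end LocallyLipschitz

/-! ### Integrating almost everywhere derivative bounds -/

section AbsolutelyContinuous

/-- A locally Lipschitz function on a compact interval is Lipschitz, hence absolutely continuous and
the integral of its derivative. -/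
theorem le_of_ae_deriv_nonneg {f : ℝ → ℝ} {a b : ℝ} (hab : a ≤ b)
    (hf : LocallyLipschitzOn (Icc a b) f)
    (hd : ∀ᵐ s ∂(volume.restrict (Icc a b)), 0 ≤ deriv f s) : f a ≤ f b := by
  obtain ⟨K, hK⟩ := hf.exists_lipschitzOnWith_of_compact isCompact_Icc
  rw [← uIcc_of_le hab] at hK
  have h := hK.absolutelyContinuousOnInterval.integral_deriv_eq_sub
  rw [← sub_nonneg, ← h]
  exact intervalIntegral.integral_nonneg_of_ae_restrict hab hd

/-- Pairing σ with a fixed vector u reduces to the scalar case: ‖u‖ B τ - ⟪u, σ⟫ has nonnegative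
derivative. Then take u = σ b - σ a. -/
theorem norm_sub_le_mul_of_ae_deriv {V : Type*} [NormedAddCommGroup V] [InnerProductSpace ℝ V]
    {τ : ℝ → ℝ} {σ : ℝ → V} {a b B : ℝ} (hab : a ≤ b)
    (hτ : LocallyLipschitzOn (Icc a b) τ) (hσ : LocallyLipschitzOn (Icc a b) σ)
    (hd : ∀ᵐ s ∂(volume.restrict (Icc a b)), DifferentiableAt ℝ τ s ∧ DifferentiableAt ℝ σ s ∧
      ‖deriv σ s‖ ≤ B * deriv τ s) :
    ‖σ b - σ a‖ ≤ B * (τ b - τ a) := by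
  have key : ∀ (u : V) (c : ℝ), ‖u‖ ≤ c →
      c * (B * τ a) - inner ℝ u (σ a) ≤ c * (B * τ b) - inner ℝ u (σ b) := fun u c hc => by
    refine le_of_ae_deriv_nonneg (f := fun s => c * (B * τ s) - inner ℝ u (σ s)) hab ?_ ?_
    · have hc : ContDiff ℝ 1 (fun p : ℝ × V => c * (B * p.1) - inner ℝ u p.2) :=
        (contDiff_const.mul (contDiff_const.mul contDiff_fst)).sub
          (contDiff_const.inner ℝ contDiff_snd)
      exact hc.locallyLipschitz.comp_locallyLipschitzOn (hτ.prodMk hσ)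
    · filter_upwards [hd] with s ⟨h1, h2, h3⟩
      have h4 : HasDerivAt (fun s => c * (B * τ s) - inner ℝ u (σ s))
          (c * (B * deriv τ s) - inner ℝ u (deriv σ s)) s := by
        have := (hasDerivAt_const s u).inner ℝ h2.hasDerivAt
        rw [inner_zero_left, add_zero] at this
        exact ((h1.hasDerivAt.const_mul B).const_mul c).sub this
      rw [h4.deriv, sub_nonneg]
      exact (real_inner_le_norm _ _).trans (mul_le_mul hc h3 (norm_nonneg _) ((norm_nonneg _).trans hc))
  rcases eq_or_ne (σ b - σ a) 0 with h0 | h0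
  -- If σ b = σ a, the nonnegativity of B (τ b - τ a) is still needed; it comes from u = 0 with the
  -- bound c = 1.
  · have := key 0 1 (by simp)
    simp only [inner_zero_left] at this
    rw [h0, norm_zero]
    linarith
  · have := key (σ b - σ a) _ le_rfl
    have h1 : inner ℝ (σ b - σ a) (σ b) - inner ℝ (σ b - σ a) (σ a) = ‖σ b - σ a‖ ^ 2 := by
      rw [← inner_sub_right, real_inner_self_eq_norm_sq]
    have h2 : 0 < ‖σ b - σ a‖ := norm_pos_iff.2 h0
    refine le_of_mul_le_mul_left ?_ h2
    nlinarith

end AbsolutelyContinuous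

/-! ### Smoothness of maps into the sphere, tested in the ambient space -/

section Sphere
variable {V : Type*} [NormedAddCommGroup V] [InnerProductSpace ℝ V]
  {n : ℕ} [Fact (Module.finrank ℝ V = n + 1)]
  {E : Type*} [NormedAddCommGroup E] [NormedSpace ℝ E]
  {H : Type*} [TopologicalSpace H] {I : ModelWithCorners ℝ E H}
  {M : Type*} [TopologicalSpace M] [ChartedSpace H M]

/-- The charts of the sphere are restrictions of smooth maps of the ambient space. -/
theorem exists_contDiffAt_eq_extChartAt_sphere (v : Metric.sphere (0 : V) 1) :
    ∃ F : V → EuclideanSpace ℝ (Fin n), (∀ p, extChartAt (𝓡 n) v p = F p) ∧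
      ContDiffAt ℝ ∞ F v := by
  let U := (OrthonormalBasis.fromOrthogonalSpanSingleton (𝕜 := ℝ) n
    (ne_zero_of_mem_unit_sphere (-v))).repr
  refine ⟨fun x => U (stereoToFun (-v : V) x), fun p => rfl, ?_⟩
  have h : ContDiffOn ℝ ∞ (stereoToFun (-v : V)) {x : V | innerSL ℝ (-v : V) x ≠ (1 : ℝ)} :=
    contDiffOn_stereoToFun
  refine U.contDiff.contDiffAt.comp _ (h.contDiffAt (IsOpen.mem_nhds ?_ ?_))
  · exact isOpen_ne_fun (by fun_prop) continuous_const
  · simp only [innerSL_apply_apply, mem_ofPred_eq, inner_neg_left, real_inner_self_eq_norm_sq]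
    rw [norm_eq_of_mem_sphere]
    norm_num

/-- The chart at f x is the restriction of an ambient map F smooth near f x, so in target
coordinates f is F composed with the ambient map. -/
theorem contMDiffWithinAt_sphere_of_coe {f : M → Metric.sphere (0 : V) 1} {s : Set M} {x : M}
    (h : ContMDiffWithinAt I 𝓘(ℝ, V) ∞ (fun y => (f y : V)) s x) :
    ContMDiffWithinAt I (𝓡 n) ∞ f s x := by
  rw [contMDiffWithinAt_iff_target]
  refine ⟨Topology.IsInducing.subtypeVal.continuousWithinAt_iff.2 h.continuousWithinAt, ?_⟩
  obtain ⟨F, hF, hFs⟩ := exists_contDiffAt_eq_extChartAt_sphere (n := n) (f x)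
  have : extChartAt (𝓡 n) (f x) ∘ f = F ∘ fun y => (f y : V) := funext fun y => hF _
  rw [this]
  exact hFs.contMDiffAt.comp_contMDiffWithinAt x h

theorem mdifferentiableAt_sphere_of_coe {f : M → Metric.sphere (0 : V) 1} {x : M}
    (h : MDifferentiableAt I 𝓘(ℝ, V) (fun y => (f y : V)) x) :
    MDifferentiableAt I (𝓡 n) f x := by
  rw [mdifferentiableAt_iff_target]
  refine ⟨Topology.IsInducing.subtypeVal.continuousAt_iff.2 h.continuousAt, ?_⟩
  obtain ⟨F, hF, hFs⟩ := exists_contDiffAt_eq_extChartAt_sphere (n := n) (f x)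
  have : extChartAt (𝓡 n) (f x) ∘ f = F ∘ fun y => (f y : V) := funext fun y => hF _
  rw [this]
  exact (hFs.differentiableAt (by simp)).mdifferentiableAt.comp x h

end Sphere

/-! ### Smoothness of pullback forms -/

section Pullback

variable {E : Type*} [NormedAddCommGroup E] [NormedSpace ℝ E]
  {H : Type*} [TopologicalSpace H] {I : ModelWithCorners ℝ E H}
  {M : Type*} [TopologicalSpace M] [ChartedSpace H M]
  {V : Type*} [NormedAddCommGroup V] [InnerProductSpace ℝ V]

theorem pullbackInner_apply (φ : M → V) (x : M) (v w : TangentSpace I x) :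
    pullbackInner I φ x v w = inner ℝ (mvfderiv I φ x v) (mvfderiv I φ x w) := rfl

theorem mvfderiv_mfderiv {E' : Type*} [NormedAddCommGroup E'] [NormedSpace ℝ E']
    {H' : Type*} [TopologicalSpace H'] {I' : ModelWithCorners ℝ E' H'}
    {M' : Type*} [TopologicalSpace M'] [ChartedSpace H' M'] {φ : M' → V} {ψ : M → M'} {x : M}
    (hφ : MDifferentiableAt I' 𝓘(ℝ, V) φ (ψ x)) (hψ : MDifferentiableAt I I' ψ x)
    (v : TangentSpace I x) :
    mvfderiv I' φ (ψ x) (mfderiv I I' ψ x v) = mvfderiv I (φ ∘ ψ) x v := by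
  unfold mvfderiv
  rw [mfderiv_comp x hφ hψ]
  rfl

theorem mvfderiv_mfderiv_one {φ : M → V} {γ : ℝ → M} {s : ℝ}
    (hφ : MDifferentiableAt I 𝓘(ℝ, V) φ (γ s)) (hγ : MDifferentiableAt 𝓘(ℝ, ℝ) I γ s) :
    mvfderiv I φ (γ s) (mfderiv 𝓘(ℝ, ℝ) I γ s (1 : ℝ)) = deriv (φ ∘ γ) s := by
  refine (mvfderiv_mfderiv hφ hγ _).trans ?_
  have h : mfderiv 𝓘(ℝ, ℝ) 𝓘(ℝ, V) (φ ∘ γ) s = fderiv ℝ (φ ∘ γ) s := mfderiv_eq_fderiv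
  exact (congrArg (fun L : ℝ →L[ℝ] V => L 1) h).trans fderiv_apply_one_eq_deriv

set_option synthInstance.maxHeartbeats 200000 in
-- The map is quadratic in L: insert L in one slot, flip, insert it in the other and flip back. The
-- flips are linear isometries.
theorem contDiff_bilinearComp_self (b : V →L[ℝ] V →L[ℝ] ℝ) :
    ContDiff ℝ ∞ (fun L : E →L[ℝ] V => b.bilinearComp L L) := by
  have h1 := LinearIsometryEquiv.contDiff (𝕜 := ℝ) (n := ∞) (E := E →L[ℝ] V →L[ℝ] ℝ)
    (F := V →L[ℝ] E →L[ℝ] ℝ) (ContinuousLinearMap.flipₗᵢ ℝ E V ℝ)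
  have h2 := LinearIsometryEquiv.contDiff (𝕜 := ℝ) (n := ∞) (E := E →L[ℝ] E →L[ℝ] ℝ)
    (F := E →L[ℝ] E →L[ℝ] ℝ) (ContinuousLinearMap.flipₗᵢ ℝ E E ℝ)
  have h3 : ContDiff ℝ ∞ fun L : E →L[ℝ] V => b.comp L := contDiff_const.clm_comp contDiff_id
  exact h2.comp ((h1.comp h3).clm_comp contDiff_id)

/-- Read in the trivialization at x₀, the form is the image of the coordinate expression of dφ under
the smooth quadratic map L ↦ ⟪L·, L·⟫. -/
theorem isSmoothMetric_pullbackInner [IsManifold I ∞ M] {φ : M → V}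
    (hφ : ContMDiff I 𝓘(ℝ, V) ∞ φ) : IsSmoothMetric I (pullbackInner I φ) := by
  intro x₀
  rw [contMDiffAt_hom_bundle]
  refine ⟨contMDiffAt_id, ?_⟩
  have h1 : ContMDiffAt I 𝓘(ℝ, E →L[ℝ] V) ∞
      (inTangentCoordinates I 𝓘(ℝ, V) id φ (mfderiv I 𝓘(ℝ, V) φ) x₀) x₀ :=
    (hφ x₀).mfderiv_const (m := ∞) (by simp)
  have h2 := contDiff_bilinearComp_self (E := E) (innerSL ℝ : V →L[ℝ] V →L[ℝ] ℝ)
  refine (h2.contMDiff.contMDiffAt.comp x₀ h1).congr_of_eventuallyEq ?_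
  have hb := (trivializationAt E (TangentSpace I) x₀).open_baseSet.mem_nhds
    (FiberBundle.mem_baseSet_trivializationAt' x₀)
  filter_upwards [hb] with x hx
  ext v w
  rw [inCoordinates_apply_eq₂ hx hx (by simp)]
  have h4 : ∀ u : E, inTangentCoordinates I 𝓘(ℝ, V) id φ (mfderiv I 𝓘(ℝ, V) φ) x₀ x u
      = mvfderiv I φ x ((trivializationAt E (TangentSpace I) x₀).symm x u) := fun u => by
    simp only [inTangentCoordinates, ContinuousLinearMap.inCoordinates]
    erw [TangentBundle.continuousLinearMapAt_model_space]
    change mvfderiv I φ x (Bundle.Trivialization.symmL ℝ (trivializationAt E (TangentSpace I) x₀) x u) = _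
    rw [Bundle.Trivialization.symmL_apply]
    exact hx
  simp only [Function.comp_apply, ContinuousLinearMap.bilinearComp_apply]
  rw [h4, h4, Bundle.Trivialization.linearMapAt_apply, if_pos (by simp)]
  rfl

theorem IsSmoothMetric.add [IsManifold I ∞ M] {g h : BilinField I M} (hg : IsSmoothMetric I g)
    (hh : IsSmoothMetric I h) : IsSmoothMetric I (fun x => g x + h x) :=
  ContMDiff.add_section hg hh

theorem IsSmoothMetric.neg [IsManifold I ∞ M] {g : BilinField I M} (hg : IsSmoothMetric I g) :
    IsSmoothMetric I (fun x => -g x) :=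
  ContMDiff.neg_section hg

theorem IsSmoothMetric.smul [IsManifold I ∞ M] {g : BilinField I M} {u : M → ℝ}
    (hu : ContMDiff I 𝓘(ℝ, ℝ) ∞ u) (hg : IsSmoothMetric I g) :
    IsSmoothMetric I (fun x => u x • g x) :=
  ContMDiff.smul_section hu hg

end Pullback

/-! ### Differentials and the time direction on products -/

section Product

variable {E : Type*} [NormedAddCommGroup E] [NormedSpace ℝ E]
  {H : Type*} [TopologicalSpace H] {I : ModelWithCorners ℝ E H}
  {N : Type*} [TopologicalSpace N] [ChartedSpace H N]
  {E' : Type*} [NormedAddCommGroup E'] [NormedSpace ℝ E']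
  {H' : Type*} [TopologicalSpace H'] {I' : ModelWithCorners ℝ E' H'}
  {N' : Type*} [TopologicalSpace N'] [ChartedSpace H' N']
  {V : Type*} [NormedAddCommGroup V] [InnerProductSpace ℝ V]
  {W : Type*} [NormedAddCommGroup W] [InnerProductSpace ℝ W]

theorem mvfderiv_comp_fst {φ : N → V} {p : N × N'} (hφ : MDifferentiableAt I 𝓘(ℝ, V) φ p.1)
    (v : TangentSpace (I.prod I') p) :
    mvfderiv (I.prod I') (fun q : N × N' => φ q.1) p v = mvfderiv I φ p.1 v.1 := by
  refine (mvfderiv_mfderiv (ψ := Prod.fst) hφ mdifferentiableAt_fst v).symm.trans ?_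
  rw [mfderiv_fst]
  rfl

theorem mvfderiv_comp_snd {φ : N' → V} {p : N × N'} (hφ : MDifferentiableAt I' 𝓘(ℝ, V) φ p.2)
    (v : TangentSpace (I.prod I') p) :
    mvfderiv (I.prod I') (fun q : N × N' => φ q.2) p v = mvfderiv I' φ p.2 v.2 := by
  refine (mvfderiv_mfderiv (ψ := Prod.snd) hφ mdifferentiableAt_snd v).symm.trans ?_
  rw [mfderiv_snd]
  rfl

theorem mvfderiv_id_real (t : ℝ) (v : TangentSpace 𝓘(ℝ, ℝ) t) :
    mvfderiv 𝓘(ℝ, ℝ) (fun s : ℝ => s) t v = v := by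
  have h : mfderiv 𝓘(ℝ, ℝ) 𝓘(ℝ, ℝ) (fun s : ℝ => s) t = _ := mfderiv_id
  unfold mvfderiv
  rw [h]
  rfl

/-- The coordinate vector field `∂_t` on `ℝ × N`. -/
noncomputable def timeDirection (I : ModelWithCorners ℝ E H) (N : Type*) [TopologicalSpace N]
    [ChartedSpace H N] : VecField (𝓘(ℝ, ℝ).prod I) (ℝ × N) :=
  fun p => mfderiv 𝓘(ℝ, ℝ) (𝓘(ℝ, ℝ).prod I) (fun s : ℝ => (s, p.2)) p.1 (1 : ℝ)

theorem timeDirection_eq (p : ℝ × N) :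
    timeDirection I N p = ((1 : ℝ), (0 : E)) := by
  unfold timeDirection
  have h := mfderiv_prod_left (I := 𝓘(ℝ, ℝ)) (I' := I) (x₀ := p.1) (y₀ := p.2)
  exact congrArg (fun L : ℝ →L[ℝ] ℝ × E => L 1) h

theorem mvfderiv_fst_timeDirection (p : ℝ × N) :
    mvfderiv (𝓘(ℝ, ℝ).prod I) (fun q : ℝ × N => q.1) p (timeDirection I N p) = 1 := by
  refine (mvfderiv_comp_fst (φ := fun s : ℝ => s) mdifferentiableAt_id _).trans
    ((mvfderiv_id_real _ _).trans ?_)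
  rw [timeDirection_eq]

theorem mvfderiv_comp_snd_timeDirection {φ : N → V} (p : ℝ × N)
    (hφ : MDifferentiableAt I 𝓘(ℝ, V) φ p.2) :
    mvfderiv (𝓘(ℝ, ℝ).prod I) (fun q : ℝ × N => φ q.2) p (timeDirection I N p) = 0 := by
  rw [mvfderiv_comp_snd hφ, timeDirection_eq]
  exact map_zero _

theorem continuous_timeDirection [IsManifold I ∞ N] :
    Continuous (fun p => (⟨p, timeDirection I N p⟩ : TangentBundle (𝓘(ℝ, ℝ).prod I) (ℝ × N))) := by
  have : IsManifold I 1 N := IsManifold.of_le (n := ∞) (by simp)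
  have h1 : Continuous fun p : ℝ × N => (⟨p.1, (1 : ℝ)⟩ : TangentBundle 𝓘(ℝ, ℝ) ℝ) := by
    have h : Continuous fun s : ℝ => (⟨s, (1 : ℝ)⟩ : TangentBundle 𝓘(ℝ, ℝ) ℝ) := by
      have := (tangentBundleModelSpaceHomeomorph 𝓘(ℝ, ℝ)).symm.continuous.comp
        (Continuous.prodMk_left (1 : ℝ))
      exact this
    exact h.comp continuous_fst
  have h2 : Continuous fun p : ℝ × N => (⟨p.2, (0 : E)⟩ : TangentBundle I N) :=
    (Bundle.contMDiff_zeroSection ℝ (TangentSpace I (M := N)) (IB := I) (n := 0)).continuous.comp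
      continuous_snd
  have h3 := (contMDiff_equivTangentBundleProd_symm (I := 𝓘(ℝ, ℝ)) (M := ℝ) (I' := I) (M' := N)
    (n := 0)).continuous.comp (h1.prodMk h2)
  convert h3 using 2 with p
  rw [timeDirection_eq]
  rfl

end Product

/-! ### A criterion for Lorentzian forms -/

section Lorentz

/-- A form `-A α² + Q` with `A > 0`, `Q` positive on nonzero vectors of the kernel of `α` and a
vector `T` in the radical of `Q` with `α T ≠ 0` is Lorentzian. -/
theorem isLorentzForm_of_eq {E : Type*} [NormedAddCommGroup E] [NormedSpace ℝ E]
    {b : E →L[ℝ] E →L[ℝ] ℝ} {A : ℝ} {α : E → ℝ} {Q : E → E → ℝ} {T : E} (hA : 0 < A)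
    (hb : ∀ v w, b v w = -(A * (α v * α w)) + Q v w) (hQ : ∀ v w, Q v w = Q w v)
    (hT : α T = 1) (hQT : ∀ w, Q T w = 0) (hpos : ∀ w, α w = 0 → w ≠ 0 → 0 < Q w w) :
    IsLorentzForm b := by
  refine ⟨fun v w => by rw [hb, hb, hQ v w]; ring, T, ?_, fun w h1 h2 => ?_⟩
  · rw [hb, hT, hQT]; linarith
  · rw [hb, hT, hQT, one_mul, add_zero, neg_eq_zero] at h1
    have h0 : α w = 0 := (mul_eq_zero.1 h1).resolve_left hA.ne'
    rw [hb, h0]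
    simpa using hpos w h0 h2

end Lorentz

/-! ### Lipschitz regularity in coordinates -/

section Lipschitz

variable {E : Type*} [NormedAddCommGroup E] [NormedSpace ℝ E]
  {H : Type*} [TopologicalSpace H] {I : ModelWithCorners ℝ E H}
  {M : Type*} [TopologicalSpace M] [ChartedSpace H M]
  {V : Type*} [NormedAddCommGroup V] [InnerProductSpace ℝ V]

theorem contDiffOn_comp_extend_symm [I.Boundaryless] [IsManifold I ∞ M] {φ : M → V}
    (hφ : ContMDiff I 𝓘(ℝ, V) ∞ φ) {e : OpenPartialHomeomorph M H}
    (he : e ∈ IsManifold.maximalAtlas I ∞ M) :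
    ContDiffOn ℝ ∞ (φ ∘ (e.extend I).symm) (e.extend I).target := by
  rw [← contMDiffOn_iff_contDiffOn]
  refine hφ.comp_contMDiffOn ?_
  have := contMDiffOn_extend_symm he
  rwa [OpenPartialHomeomorph.extend_target']

theorem mvfderiv_mfderiv_extend_symm [I.Boundaryless] [IsManifold I ∞ M] {φ : M → V}
    (hφ : ContMDiff I 𝓘(ℝ, V) ∞ φ) {e : OpenPartialHomeomorph M H}
    (he : e ∈ IsManifold.maximalAtlas I ∞ M) {y : E} (hy : y ∈ (e.extend I).target) (v : E) :
    mvfderiv I φ ((e.extend I).symm y) (mfderiv 𝓘(ℝ, E) I (e.extend I).symm y v) =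
      fderiv ℝ (φ ∘ (e.extend I).symm) y v := by
  have h := contMDiffOn_extend_symm he
  rw [← OpenPartialHomeomorph.extend_target'] at h
  have h1 := ((h y hy).contMDiffAt
    ((OpenPartialHomeomorph.isOpen_extend_target e).mem_nhds hy)).mdifferentiableAt (by simp)
  refine (mvfderiv_mfderiv (hφ.mdifferentiable (by simp) _) h1 v).trans ?_
  have h2 : mfderiv 𝓘(ℝ, E) 𝓘(ℝ, V) (φ ∘ (e.extend I).symm) y
    = fderiv ℝ (φ ∘ (e.extend I).symm) y := mfderiv_eq_fderiv
  exact congrArg (fun L : E →L[ℝ] V => L v) h2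

/-- In coordinates the components are inner products of directional derivatives of φ ∘ e⁻¹, which
are C¹. -/
theorem locallyLipschitzOn_pullbackInner_component [I.Boundaryless] [IsManifold I ∞ M] {φ : M → V}
    (hφ : ContMDiff I 𝓘(ℝ, V) ∞ φ) {e : OpenPartialHomeomorph M H}
    (he : e ∈ IsManifold.maximalAtlas I ∞ M) (v w : E) :
    LocallyLipschitzOn (e.extend I).target (metricComponent I (pullbackInner I φ) e v w) := by
  have ho := OpenPartialHomeomorph.isOpen_extend_target e (I := I)
  have h1 := (contDiffOn_comp_extend_symm hφ he).fderiv_of_isOpen ho (m := 1) (by norm_cast)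
  have h2 : ContDiffOn ℝ 1 (fun y => inner ℝ (fderiv ℝ (φ ∘ (e.extend I).symm) y v)
      (fderiv ℝ (φ ∘ (e.extend I).symm) y w)) (e.extend I).target :=
    (h1.clm_apply contDiffOn_const).inner ℝ (h1.clm_apply contDiffOn_const)
  refine (h2.congr fun y hy => ?_).locallyLipschitzOn_of_isOpen ho
  exact (pullbackInner_apply φ _ _ _).trans (congrArg₂ (inner ℝ)
    (mvfderiv_mfderiv_extend_symm hφ he hy v) (mvfderiv_mfderiv_extend_symm hφ he hy w))

/-- Near t, continuity keeps γ in the chart at γ t, where φ ∘ γ factors as the smooth φ ∘ chart⁻¹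
after the Lipschitz chart ∘ γ. -/
theorem locallyLipschitzOn_comp_of_chart [I.Boundaryless] [IsManifold I ∞ M] {φ : M → V}
    (hφ : ContMDiff I 𝓘(ℝ, V) ∞ φ) {γ : ℝ → M} {s : Set ℝ} (hc : ContinuousOn γ s)
    (hL : ∀ t ∈ s, ∃ C, ∃ u ∈ 𝓝[s] t, LipschitzOnWith C (extChartAt I (γ t) ∘ γ) u) :
    LocallyLipschitzOn s (φ ∘ γ) := by
  intro t ht
  obtain ⟨C, u, hu, hC⟩ := hL t ht
  have h1 : ContDiffOn ℝ ∞ (φ ∘ (extChartAt I (γ t)).symm) (extChartAt I (γ t)).target :=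
    contDiffOn_comp_extend_symm hφ (IsManifold.chart_mem_maximalAtlas (γ t))
  obtain ⟨K, v, hv, hK⟩ := ((h1.contDiffAt (extChartAt_target_mem_nhds (γ t))).of_le
    (m := 1) (by simp)).exists_lipschitzOnWith
  have hcs : ContinuousWithinAt (extChartAt I (γ t) ∘ γ) s t :=
    (continuousAt_extChartAt (γ t)).comp_continuousWithinAt (hc t ht)
  refine ⟨K * C, u ∩ (extChartAt I (γ t) ∘ γ) ⁻¹' v ∩ γ ⁻¹' (extChartAt I (γ t)).source, ?_, ?_⟩
  · exact inter_mem (inter_mem hu (hcs hv)) (hc t ht (extChartAt_source_mem_nhds (γ t)))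
  · have h2 := hK.comp (hC.mono (inter_subset_left.trans inter_subset_left :
      u ∩ (extChartAt I (γ t) ∘ γ) ⁻¹' v ∩ γ ⁻¹' (extChartAt I (γ t)).source ⊆ u))
      fun x hx => hx.1.2
    intro x hx y hy
    have h3 := h2 hx hy
    simp only [Function.comp_apply, (extChartAt I (γ t)).left_inv hx.2,
      (extChartAt I (γ t)).left_inv hy.2] at h3
    exact h3

end Lipschitz

/-! ### The spacetime ℝ × S^n with metric -w² dt² + dω² -/

section Warped

variable {V : Type*} [NormedAddCommGroup V] [InnerProductSpace ℝ V]
  {n : ℕ} [Fact (Module.finrank ℝ V = n + 1)]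

/-- The metric `-w² dt² + dω²` on `ℝ × S^n`, where `dω²` is the round metric. -/
noncomputable def warpedMetric (n : ℕ) [Fact (Module.finrank ℝ V = n + 1)]
    (w : Metric.sphere (0 : V) 1 → ℝ) :
    BilinField (𝓘(ℝ, ℝ).prod (𝓡 n)) (ℝ × Metric.sphere (0 : V) 1) := fun p =>
  -(w p.2 ^ 2 • pullbackInner (𝓘(ℝ, ℝ).prod (𝓡 n)) (fun q : ℝ × Metric.sphere (0 : V) 1 => q.1) p)
    + pullbackInner (𝓘(ℝ, ℝ).prod (𝓡 n)) (fun q : ℝ × Metric.sphere (0 : V) 1 => (q.2 : V)) p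

theorem warpedMetric_apply (w : Metric.sphere (0 : V) 1 → ℝ) (p : ℝ × Metric.sphere (0 : V) 1)
    (u v : TangentSpace (𝓘(ℝ, ℝ).prod (𝓡 n)) p) :
    warpedMetric n w p u v =
      -(w p.2 ^ 2 * (mvfderiv (𝓘(ℝ, ℝ).prod (𝓡 n)) (fun q => q.1) p u *
        mvfderiv (𝓘(ℝ, ℝ).prod (𝓡 n)) (fun q => q.1) p v)) +
      inner ℝ (mvfderiv (𝓘(ℝ, ℝ).prod (𝓡 n)) (fun q => (q.2 : V)) p u)
        (mvfderiv (𝓘(ℝ, ℝ).prod (𝓡 n)) (fun q => (q.2 : V)) p v) := by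
  change -(w p.2 ^ 2 * pullbackInner _ _ p u v) + pullbackInner _ _ p u v = _
  rw [pullbackInner_apply, pullbackInner_apply, Real.inner_apply]

theorem contMDiff_fst_warped : ContMDiff (𝓘(ℝ, ℝ).prod (𝓡 n)) 𝓘(ℝ, ℝ) ∞
    (fun q : ℝ × Metric.sphere (0 : V) 1 => q.1) := contMDiff_fst

theorem contMDiff_coe_snd_warped : ContMDiff (𝓘(ℝ, ℝ).prod (𝓡 n)) 𝓘(ℝ, V) ∞
    (fun q : ℝ × Metric.sphere (0 : V) 1 => (q.2 : V)) :=
  contMDiff_coe_sphere.comp contMDiff_snd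

theorem isLipschitzFunction_of_coe_snd {φ : V → ℝ} (hφ : LocallyLipschitz φ) :
    IsLipschitzFunction (𝓘(ℝ, ℝ).prod (𝓡 n)) (fun q : ℝ × Metric.sphere (0 : V) 1 => φ q.2) := by
  intro e he
  have h := ((contDiffOn_comp_extend_symm contMDiff_coe_snd_warped he).of_le (m := 1)
    (by simp)).locallyLipschitzOn_of_isOpen (OpenPartialHomeomorph.isOpen_extend_target e)
  exact hφ.comp_locallyLipschitzOn h

theorem locallyLipschitzOn_comp_snd_extend_symm {w : Metric.sphere (0 : V) 1 → ℝ}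
    (hw : LocallyLipschitz w)
    {e : OpenPartialHomeomorph (ℝ × Metric.sphere (0 : V) 1) (ModelProd ℝ (EuclideanSpace ℝ (Fin n)))}
    (he : e ∈ IsManifold.maximalAtlas (𝓘(ℝ, ℝ).prod (𝓡 n)) ∞ (ℝ × Metric.sphere (0 : V) 1)) :
    LocallyLipschitzOn (e.extend (𝓘(ℝ, ℝ).prod (𝓡 n))).target
      (fun y => w ((e.extend (𝓘(ℝ, ℝ).prod (𝓡 n))).symm y).2) := by
  have h := ((contDiffOn_comp_extend_symm contMDiff_coe_snd_warped he).of_le (m := 1)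
    (by simp)).locallyLipschitzOn_of_isOpen (OpenPartialHomeomorph.isOpen_extend_target e)
  exact hw.comp_locallyLipschitzOn (f := fun y => ((e.extend (𝓘(ℝ, ℝ).prod (𝓡 n))).symm y).2) h

theorem isLipschitzMetric_warpedMetric {w : Metric.sphere (0 : V) 1 → ℝ}
    (hw : LocallyLipschitz w) :
    IsLipschitzMetric (𝓘(ℝ, ℝ).prod (𝓡 n)) (warpedMetric n w) := by
  intro e he u v
  have h1 := locallyLipschitzOn_pullbackInner_component contMDiff_fst_warped he u v
  have h2 := locallyLipschitzOn_pullbackInner_component contMDiff_coe_snd_warped he u v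
  have h3 := locallyLipschitzOn_comp_snd_extend_symm hw he
  have h4 : ContDiff ℝ 1 fun x : ℝ × ℝ × ℝ => -(x.1 ^ 2 * x.2.1) + x.2.2 := by fun_prop
  exact h4.locallyLipschitz.comp_locallyLipschitzOn (h3.prodMk (h1.prodMk h2))

theorem eq_zero_of_mvfderiv_coe_sphere {x : Metric.sphere (0 : V) 1} {v : TangentSpace (𝓡 n) x}
    (hv : mvfderiv (𝓡 n) ((↑) : Metric.sphere (0 : V) 1 → V) x v = 0) : v = 0 :=
  injective_mvfderiv_subtypeVal_sphere x (hv.trans (map_zero _).symm)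

theorem mdifferentiableAt_coe_sphere (x : Metric.sphere (0 : V) 1) :
    MDifferentiableAt (𝓡 n) 𝓘(ℝ, V) ((↑) : Metric.sphere (0 : V) 1 → V) x :=
  (contMDiff_coe_sphere (m := 1)).mdifferentiable (by simp) x

theorem connectedSpace_sphere {V : Type*} [NormedAddCommGroup V] [InnerProductSpace ℝ V]
    [FiniteDimensional ℝ V] {n : ℕ} [Fact (Module.finrank ℝ V = n + 1)] (hn : 1 ≤ n) :
    ConnectedSpace (Metric.sphere (0 : V) 1) := by
  have h : IsConnected (Metric.sphere (0 : V) 1) := by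
    refine isConnected_sphere ?_ 0 zero_le_one
    rw [← Module.finrank_eq_rank, Fact.out (p := Module.finrank ℝ V = n + 1)]
    exact_mod_cast Nat.lt_add_of_pos_left hn
  exact isConnected_iff_connectedSpace.1 h

theorem isSpacetime_warpedMetric [FiniteDimensional ℝ V] (hn : 1 ≤ n)
    {w : Metric.sphere (0 : V) 1 → ℝ} (hw : ∀ x, 0 < w x) :
    IsSpacetime (𝓘(ℝ, ℝ).prod (𝓡 n)) n (warpedMetric n w)
      (timeDirection (𝓡 n) (Metric.sphere (0 : V) 1)) where
  finrank_eq := by simp [add_comm]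
  boundaryless := inferInstance
  t2 := inferInstance
  secondCountable := inferInstance
  connected := by
    have := connectedSpace_sphere (V := V) hn
    infer_instance
  lorentz p := by
    refine isLorentzForm_of_eq (A := w p.2 ^ 2) (T := timeDirection (𝓡 n) _ p) (pow_pos (hw _) 2)
      (warpedMetric_apply w p) (fun v w => real_inner_comm _ _) (mvfderiv_fst_timeDirection p)
      (fun u => ?_) (fun u h1 h2 => ?_)
    · rw [mvfderiv_comp_snd_timeDirection p (mdifferentiableAt_coe_sphere _), inner_zero_left]
    · rw [real_inner_self_eq_norm_sq]
      refine pow_pos (norm_pos_iff.2 fun h => h2 ?_) 2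
      have h3 := (mvfderiv_comp_fst (φ := fun s : ℝ => s) mdifferentiableAt_id u).symm.trans h1
      have h4 := (mvfderiv_comp_snd (mdifferentiableAt_coe_sphere p.2) u).symm.trans h
      exact Prod.ext ((mvfderiv_id_real _ _).symm.trans h3) (eq_zero_of_mvfderiv_coe_sphere h4)
  timelike p := by
    rw [warpedMetric_apply, mvfderiv_fst_timeDirection,
      mvfderiv_comp_snd_timeDirection p (mdifferentiableAt_coe_sphere _), inner_zero_left]
    have := pow_pos (hw p.2) 2
    linarith
  continuous_timeOrientation := continuous_timeDirection

end Warped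

/-! ### Causal curves as curves obeying a speed limit -/

section Causal

variable {V : Type*} [NormedAddCommGroup V] [InnerProductSpace ℝ V]
  {n : ℕ} [Fact (Module.finrank ℝ V = n + 1)]

theorem mvfderiv_fst_velocity {γ : ℝ → ℝ × Metric.sphere (0 : V) 1} {s : ℝ}
    (h : MDifferentiableAt 𝓘(ℝ, ℝ) (𝓘(ℝ, ℝ).prod (𝓡 n)) γ s) :
    mvfderiv (𝓘(ℝ, ℝ).prod (𝓡 n)) (fun q => q.1) (γ s)
      (mfderiv 𝓘(ℝ, ℝ) (𝓘(ℝ, ℝ).prod (𝓡 n)) γ s (1 : ℝ)) = deriv (fun s => (γ s).1) s :=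
  mvfderiv_mfderiv_one (φ := fun q : ℝ × Metric.sphere (0 : V) 1 => q.1) mdifferentiableAt_fst h

theorem mvfderiv_snd_velocity {γ : ℝ → ℝ × Metric.sphere (0 : V) 1} {s : ℝ}
    (h : MDifferentiableAt 𝓘(ℝ, ℝ) (𝓘(ℝ, ℝ).prod (𝓡 n)) γ s) :
    mvfderiv (𝓘(ℝ, ℝ).prod (𝓡 n)) (fun q => (q.2 : V)) (γ s)
      (mfderiv 𝓘(ℝ, ℝ) (𝓘(ℝ, ℝ).prod (𝓡 n)) γ s (1 : ℝ)) = deriv (fun s => ((γ s).2 : V)) s :=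
  mvfderiv_mfderiv_one (φ := fun q : ℝ × Metric.sphere (0 : V) 1 => (q.2 : V))
    (contMDiff_coe_snd_warped.mdifferentiable (by simp) _) h

theorem warpedMetric_velocity (w : Metric.sphere (0 : V) 1 → ℝ)
    {γ : ℝ → ℝ × Metric.sphere (0 : V) 1} {s : ℝ}
    (h : MDifferentiableAt 𝓘(ℝ, ℝ) (𝓘(ℝ, ℝ).prod (𝓡 n)) γ s) :
    warpedMetric n w (γ s) (mfderiv 𝓘(ℝ, ℝ) (𝓘(ℝ, ℝ).prod (𝓡 n)) γ s (1 : ℝ))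
        (mfderiv 𝓘(ℝ, ℝ) (𝓘(ℝ, ℝ).prod (𝓡 n)) γ s (1 : ℝ)) =
      -(w (γ s).2 ^ 2 * deriv (fun s => (γ s).1) s ^ 2) +
        ‖deriv (fun s => ((γ s).2 : V)) s‖ ^ 2 := by
  refine (warpedMetric_apply w (γ s) _ _).trans ?_
  rw [← real_inner_self_eq_norm_sq, sq (deriv _ _)]
  exact congrArg₂ (fun a b => -(w (γ s).2 ^ 2 * (a * a)) + inner ℝ b b)
    (mvfderiv_fst_velocity h) (mvfderiv_snd_velocity h)

theorem warpedMetric_velocity_timeDirection (w : Metric.sphere (0 : V) 1 → ℝ)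
    {γ : ℝ → ℝ × Metric.sphere (0 : V) 1} {s : ℝ}
    (h : MDifferentiableAt 𝓘(ℝ, ℝ) (𝓘(ℝ, ℝ).prod (𝓡 n)) γ s) :
    warpedMetric n w (γ s) (mfderiv 𝓘(ℝ, ℝ) (𝓘(ℝ, ℝ).prod (𝓡 n)) γ s (1 : ℝ))
        (timeDirection (𝓡 n) (Metric.sphere (0 : V) 1) (γ s)) =
      -(w (γ s).2 ^ 2 * deriv (fun s => (γ s).1) s) := by
  refine (warpedMetric_apply w (γ s) _ _).trans ?_
  rw [mvfderiv_fst_timeDirection,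
    mvfderiv_comp_snd_timeDirection (γ s) (mdifferentiableAt_coe_sphere _), inner_zero_right,
    add_zero, mul_one]
  exact congrArg (fun a => -(w (γ s).2 ^ 2 * a)) (mvfderiv_fst_velocity h)

/-- Pairing the velocity with ∂_t fixes the sign of t'; once t' > 0, the inequality |σ'|² ≤ w² t'²
has a square root. From here on causality is a speed limit for the spatial part, measured in the
ambient norm. -/
theorem futureCausal_velocity_iff {w : Metric.sphere (0 : V) 1 → ℝ} (hw : ∀ x, 0 < w x)
    {γ : ℝ → ℝ × Metric.sphere (0 : V) 1} {s : ℝ}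
    (h : MDifferentiableAt 𝓘(ℝ, ℝ) (𝓘(ℝ, ℝ).prod (𝓡 n)) γ s) :
    FutureCausal (𝓘(ℝ, ℝ).prod (𝓡 n)) (warpedMetric n w) (timeDirection (𝓡 n) _) (γ s)
        (mfderiv 𝓘(ℝ, ℝ) (𝓘(ℝ, ℝ).prod (𝓡 n)) γ s (1 : ℝ)) ↔
      0 < deriv (fun s => (γ s).1) s ∧
        ‖deriv (fun s => ((γ s).2 : V)) s‖ ≤ w (γ s).2 * deriv (fun s => (γ s).1) s := by
  unfold FutureCausal
  rw [warpedMetric_velocity w h, warpedMetric_velocity_timeDirection w h]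
  have h0 := hw (γ s).2
  have h1 : -(w (γ s).2 ^ 2 * deriv (fun s => (γ s).1) s) < 0 ↔ 0 < deriv (fun s => (γ s).1) s := by
    rw [neg_lt_zero]
    exact mul_pos_iff_of_pos_left (pow_pos h0 2)
  rw [h1, and_comm]
  refine and_congr_right fun h2 => ?_
  rw [← mul_pow, neg_add_nonpos_iff, sq_le_sq₀ (norm_nonneg _) (mul_pos h0 h2).le]

section CausalCurve

variable {w : Metric.sphere (0 : V) 1 → ℝ} {γ : ℝ → ℝ × Metric.sphere (0 : V) 1} {a b : ℝ}

theorem IsCausalCurveOn.norm_sub_le (hw : ∀ x, 0 < w x)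
    (h : IsCausalCurveOn (𝓘(ℝ, ℝ).prod (𝓡 n)) (warpedMetric n w) (timeDirection (𝓡 n) _) γ a b)
    {s₁ s₂ B : ℝ} (h1 : s₁ ∈ Icc a b) (h2 : s₂ ∈ Icc a b) (h12 : s₁ ≤ s₂)
    (hB : ∀ s ∈ Icc s₁ s₂, w (γ s).2 ≤ B) :
    ‖((γ s₂).2 : V) - (γ s₁).2‖ ≤ B * ((γ s₂).1 - (γ s₁).1) := by
  have hsub : Icc s₁ s₂ ⊆ Icc a b := Icc_subset_Icc h1.1 h2.2
  refine norm_sub_le_mul_of_ae_deriv h12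
    ((locallyLipschitzOn_comp_of_chart contMDiff_fst_warped h.continuousOn
      h.locallyLipschitz).mono hsub)
    ((locallyLipschitzOn_comp_of_chart contMDiff_coe_snd_warped h.continuousOn
      h.locallyLipschitz).mono hsub) ?_
  filter_upwards [ae_restrict_of_ae_restrict_of_subset hsub h.futureCausal,
    ae_restrict_mem measurableSet_Icc] with s ⟨hs1, hs2⟩ hs
  obtain ⟨h3, h4⟩ := (futureCausal_velocity_iff hw hs1).1 hs2
  refine ⟨(contMDiff_fst_warped.mdifferentiable (by simp) _ |>.comp s hs1).differentiableAt,
    (contMDiff_coe_snd_warped.mdifferentiable (by simp) _ |>.comp s hs1).differentiableAt,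
    h4.trans (mul_le_mul_of_nonneg_right (hB s hs) h3.le)⟩

theorem IsCausalCurveOn.monotoneOn (hw : ∀ x, 0 < w x)
    (h : IsCausalCurveOn (𝓘(ℝ, ℝ).prod (𝓡 n)) (warpedMetric n w) (timeDirection (𝓡 n) _) γ a b) :
    MonotoneOn (fun s => (γ s).1) (Icc a b) := by
  intro s₁ h1 s₂ h2 h12
  have hsub : Icc s₁ s₂ ⊆ Icc a b := Icc_subset_Icc h1.1 h2.2
  refine le_of_ae_deriv_nonneg h12 ((locallyLipschitzOn_comp_of_chart contMDiff_fst_warped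
    h.continuousOn h.locallyLipschitz).mono hsub) ?_
  filter_upwards [ae_restrict_of_ae_restrict_of_subset hsub h.futureCausal] with s ⟨hs1, hs2⟩
  exact ((futureCausal_velocity_iff hw hs1).1 hs2).1.le

theorem IsCausalCurveOn.norm_sub_le_of_le (hw : ∀ x, 0 < w x) {C : ℝ} (hC : ∀ x, w x ≤ C)
    (h : IsCausalCurveOn (𝓘(ℝ, ℝ).prod (𝓡 n)) (warpedMetric n w) (timeDirection (𝓡 n) _) γ a b)
    {s₁ s₂ : ℝ} (h1 : s₁ ∈ Icc a b) (h2 : s₂ ∈ Icc a b) :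
    ‖((γ s₂).2 : V) - (γ s₁).2‖ ≤ C * |(γ s₂).1 - (γ s₁).1| := by
  have hC0 : 0 ≤ C := (hw (γ a).2).le.trans (hC _)
  rcases le_total s₁ s₂ with h12 | h12
  · exact (h.norm_sub_le hw h1 h2 h12 fun s _ => hC _).trans (by gcongr; exact le_abs_self _)
  · rw [norm_sub_rev, abs_sub_comm]
    exact (h.norm_sub_le hw h2 h1 h12 fun s _ => hC _).trans (by gcongr; exact le_abs_self _)

/-- The speed bound along a causal curve, anchored at the speed limit at one end point. -/
theorem IsCausalCurveOn.norm_sub_le_anchored (hw : ∀ x, 0 < w x) {C : ℝ} (hC : ∀ x, w x ≤ C)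
    {K : NNReal} (hK : LipschitzWith K w)
    (h : IsCausalCurveOn (𝓘(ℝ, ℝ).prod (𝓡 n)) (warpedMetric n w) (timeDirection (𝓡 n) _) γ a b)
    {s₁ s₂ : ℝ} (h1 : s₁ ∈ Icc a b) (h2 : s₂ ∈ Icc a b) :
    ‖((γ s₂).2 : V) - (γ s₁).2‖ ≤
      (w (γ s₁).2 + K * C * |(γ s₂).1 - (γ s₁).1|) * |(γ s₂).1 - (γ s₁).1| := by
  have hC0 : 0 ≤ C := (hw (γ a).2).le.trans (hC _)
  -- Time is monotone, so the curve moves at most C|Δt| away from its anchor; being K-Lipschitz, w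
  -- then grows by at most K C |Δt|.
  have key : ∀ s ∈ uIcc s₁ s₂, w (γ s).2 ≤ w (γ s₁).2 + K * C * |(γ s₂).1 - (γ s₁).1| := by
    intro s hs
    have hs' : s ∈ Icc a b := uIcc_subset_Icc h1 h2 hs
    have h3 := hK.dist_le_mul (γ s).2 (γ s₁).2
    rw [Real.dist_eq, Subtype.dist_eq, dist_eq_norm] at h3
    have h4 := h.norm_sub_le_of_le hw hC h1 hs'
    have h5 : |(γ s).1 - (γ s₁).1| ≤ |(γ s₂).1 - (γ s₁).1| := by
      rcases le_total s₁ s₂ with h12 | h12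
      · rw [uIcc_of_le h12] at hs
        have h6 := h.monotoneOn hw h1 hs' hs.1
        have h7 := h.monotoneOn hw hs' h2 hs.2
        simp only at h6 h7
        rw [abs_of_nonneg (by linarith), abs_of_nonneg (by linarith)]; linarith
      · rw [uIcc_of_ge h12] at hs
        have h6 := h.monotoneOn hw hs' h1 hs.2
        have h7 := h.monotoneOn hw h2 hs' hs.1
        simp only at h6 h7
        rw [abs_of_nonpos (by linarith), abs_of_nonpos (by linarith)]; linarith
    have h6 : (K : ℝ) * ‖((γ s).2 : V) - (γ s₁).2‖ ≤ K * (C * |(γ s₂).1 - (γ s₁).1|) := by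
      gcongr
      exact h4.trans (by gcongr)
    have h7 := (le_abs_self _).trans (h3.trans h6)
    linarith
  have hp : 0 ≤ w (γ s₁).2 + K * C * |(γ s₂).1 - (γ s₁).1| :=
    add_nonneg (hw _).le (by positivity)
  rcases le_total s₁ s₂ with h12 | h12
  · rw [uIcc_of_le h12] at key
    exact (h.norm_sub_le hw h1 h2 h12 key).trans (by gcongr; exact le_abs_self _)
  · rw [uIcc_of_ge h12] at key
    rw [norm_sub_rev]
    refine (h.norm_sub_le hw h2 h1 h12 key).trans ?_
    gcongr
    rw [abs_sub_comm]
    exact le_abs_self _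

end CausalCurve

/-- Curves in the sphere whose speed is at most `w`, in a form that is closed under pointwise
limits. -/
def speedLimitCurves (w : Metric.sphere (0 : V) 1 → ℝ) (C A : ℝ) :
    Set (ℝ → Metric.sphere (0 : V) 1) :=
  {σ | ∀ s t, ‖(σ t : V) - σ s‖ ≤ C * |t - s| ∧
    ‖(σ t : V) - σ s‖ ≤ (w (σ s) + A * |t - s|) * |t - s|}

/-- For fixed s and t the conditions involve only the two values σ s and σ t, so they are closed in
the product topology. -/
theorem isClosed_speedLimitCurves {w : Metric.sphere (0 : V) 1 → ℝ} (hw : Continuous w) (C A : ℝ) :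
    IsClosed (speedLimitCurves w C A) := by
  simp only [speedLimitCurves, ofPred_forall, ofPred_and]
  refine isClosed_iInter fun s => isClosed_iInter fun t => ?_
  have h1 : Continuous fun σ : ℝ → Metric.sphere (0 : V) 1 => ‖(σ t : V) - σ s‖ := by fun_prop
  exact (isClosed_le h1 continuous_const).inter (isClosed_le h1 (by fun_prop))

theorem lipschitzWith_of_mem_speedLimitCurves {w : Metric.sphere (0 : V) 1 → ℝ} {C A : ℝ}
    (hC : 0 ≤ C) {σ : ℝ → Metric.sphere (0 : V) 1} (hσ : σ ∈ speedLimitCurves w C A) :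
    LipschitzWith C.toNNReal σ :=
  LipschitzWith.of_dist_le_mul fun t s => by
    rw [Subtype.dist_eq, dist_eq_norm, Real.coe_toNNReal _ hC, Real.dist_eq]
    exact (hσ s t).1

/-- The family is closed in a product of compact spheres, hence compact by Tychonoff's theorem.
Evaluation (t, σ) ↦ σ t is jointly continuous on it because all members share the Lipschitz constant
C. -/
theorem isCompact_image_eval_speedLimitCurves [FiniteDimensional ℝ V]
    {w : Metric.sphere (0 : V) 1 → ℝ} (hw : Continuous w) {C : ℝ} (hC : 0 ≤ C) (A : ℝ)
    (t₀ t₁ s : ℝ) (x : Metric.sphere (0 : V) 1) :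
    IsCompact ((fun z : ℝ × (ℝ → Metric.sphere (0 : V) 1) => (z.1, z.2 z.1)) ''
      (Icc t₀ t₁ ×ˢ {σ | σ ∈ speedLimitCurves w C A ∧ σ s = x})) := by
  have hcl : IsClosed {σ | σ ∈ speedLimitCurves w C A ∧ σ s = x} :=
    (isClosed_speedLimitCurves hw C A).inter (isClosed_eq (continuous_apply s) continuous_const)
  refine (isCompact_Icc.prod hcl.isCompact).image_of_continuousOn ?_
  refine continuousOn_fst.prodMk ?_
  exact continuousOn_prod_of_continuousOn_lipschitzOnWith
    (fun z : ℝ × (ℝ → Metric.sphere (0 : V) 1) => z.2 z.1) C.toNNReal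
    (fun t _ => (continuous_apply t).continuousOn)
    fun σ hσ => (lipschitzWith_of_mem_speedLimitCurves hC hσ.1).lipschitzOnWith

end Causal

/-! ### Global hyperbolicity for a bounded positive Lipschitz w -/

section GloballyHyperbolic

variable {V : Type*} [NormedAddCommGroup V] [InnerProductSpace ℝ V]
  {n : ℕ} [Fact (Module.finrank ℝ V = n + 1)]
  {w : Metric.sphere (0 : V) 1 → ℝ} {C : ℝ} {K : NNReal}

/-- The curve is reparametrized by time: by the intermediate value theorem every time between the
end points is attained. Clamping t to this interval extends the result to all of ℝ, constant
outside. -/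
theorem exists_speedLimitCurve_of_mem_causalFuture (hw : ∀ x, 0 < w x) (hC : ∀ x, w x ≤ C)
    (hK : LipschitzWith K w) {p q : ℝ × Metric.sphere (0 : V) 1}
    (h : q ∈ causalFuture (𝓘(ℝ, ℝ).prod (𝓡 n)) (warpedMetric n w) (timeDirection (𝓡 n) _) p) :
    p.1 ≤ q.1 ∧ ∃ σ ∈ speedLimitCurves w C (K * C), σ p.1 = p.2 ∧ σ q.1 = q.2 := by
  have hC0 : 0 ≤ C := (hw p.2).le.trans (hC _)
  rcases h with rfl | ⟨γ, a, b, hγ, rfl, rfl⟩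
  · refine ⟨le_rfl, fun _ => q.2, fun s t => ?_, rfl, rfl⟩
    rw [sub_self, norm_zero]
    exact ⟨by positivity, mul_nonneg (add_nonneg (hw _).le (by positivity)) (abs_nonneg _)⟩
  have ha : a ∈ Icc a b := left_mem_Icc.2 hγ.lt.le
  have hb : b ∈ Icc a b := right_mem_Icc.2 hγ.lt.le
  have hab : (γ a).1 ≤ (γ b).1 := hγ.monotoneOn hw ha hb hγ.lt.le
  have hex : ∀ t : ℝ, ∃ s ∈ Icc a b, (γ s).1 = projIcc _ _ hab t := fun t => by
    have := intermediate_value_Icc hγ.lt.le (continuous_fst.comp_continuousOn hγ.continuousOn)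
      (projIcc _ _ hab t).2
    exact this
  choose s hs hst using hex
  -- The choice of parameter is harmless: by the uniform speed bound, points of the curve with equal
  -- times coincide.
  have heq : ∀ r ∈ Icc a b, ∀ t, (γ r).1 = (γ (s t)).1 → (γ (s t)).2 = (γ r).2 := fun r hr t h => by
    have := hγ.norm_sub_le_of_le hw hC hr (hs t)
    rw [h, sub_self, abs_zero, mul_zero, norm_le_zero_iff, sub_eq_zero] at this
    exact Subtype.ext this
  refine ⟨hab, fun t => (γ (s t)).2, fun t t' => ?_, heq a ha _ ?_, heq b hb _ ?_⟩
  · have h1 := hγ.norm_sub_le_of_le hw hC (hs t) (hs t')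
    have h2 := hγ.norm_sub_le_anchored hw hC hK (hs t) (hs t')
    have h3 : |(γ (s t')).1 - (γ (s t)).1| ≤ |t' - t| := by
      rw [hst, hst]
      exact abs_projIcc_sub_projIcc hab
    refine ⟨h1.trans (by gcongr), h2.trans ?_⟩
    have := (hw (γ (s t)).2).le
    gcongr
  · rw [hst, projIcc_of_mem hab (left_mem_Icc.2 hab)]
  · rw [hst, projIcc_of_mem hab (right_mem_Icc.2 hab)]

/-- After division by |t - s| the correction A|t - s| vanishes as t → s, so the closed condition
gives back the sharp speed limit. -/
theorem norm_deriv_le_of_mem_speedLimitCurves {A : ℝ} {σ : ℝ → Metric.sphere (0 : V) 1}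
    (hσ : σ ∈ speedLimitCurves w C A) {s : ℝ}
    (hd : DifferentiableAt ℝ (fun s => (σ s : V)) s) :
    ‖deriv (fun s => (σ s : V)) s‖ ≤ w (σ s) := by
  have h1 := hd.hasDerivAt.tendsto_slope.norm
  have h2 : Tendsto (fun t => w (σ s) + A * |t - s|) (𝓝[≠] s) (𝓝 (w (σ s))) := by
    have : Continuous fun t => w (σ s) + A * |t - s| := by fun_prop
    simpa using (this.tendsto s).mono_left nhdsWithin_le_nhds
  refine le_of_tendsto_of_tendsto h1 h2 ?_
  filter_upwards [self_mem_nhdsWithin] with t ht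
  have h3 : 0 < |t - s| := abs_pos.2 (sub_ne_zero.2 ht)
  rw [slope_def_module, norm_smul, norm_inv, Real.norm_eq_abs, inv_mul_le_iff₀ h3, mul_comm]
  exact (hσ s t).2

/-- The graph over the time axis has t' = 1, and a Lipschitz σ is differentiable almost everywhere
by Rademacher's theorem. -/
theorem isCausalCurveOn_of_mem_speedLimitCurves [FiniteDimensional ℝ V] (hw : ∀ x, 0 < w x)
    (hC : 0 ≤ C) {A : ℝ} {σ : ℝ → Metric.sphere (0 : V) 1} (hσ : σ ∈ speedLimitCurves w C A)
    {a b : ℝ} (hab : a < b) :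
    IsCausalCurveOn (𝓘(ℝ, ℝ).prod (𝓡 n)) (warpedMetric n w) (timeDirection (𝓡 n) _)
      (fun t => (t, σ t)) a b where
  lt := hab
  continuousOn := (continuous_id.prodMk
    (lipschitzWith_of_mem_speedLimitCurves hC hσ).continuous).continuousOn
  locallyLipschitz s _ := by
    have hL := lipschitzWith_of_mem_speedLimitCurves hC hσ
    obtain ⟨F, hF, hFs⟩ := exists_contDiffAt_eq_extChartAt_sphere (n := n) (σ s)
    obtain ⟨K', t, ht, hK'⟩ := (hFs.of_le (m := 1) (by simp)).exists_lipschitzOnWith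
    have ht' : (fun s => (σ s : V)) ⁻¹' t ∈ 𝓝 s :=
      (continuous_subtype_val.comp hL.continuous).continuousAt ht
    have h1 : LipschitzOnWith (K' * C.toNNReal) (fun r => F (σ r)) ((fun s => (σ s : V)) ⁻¹' t) :=
      hK'.comp (show LipschitzOnWith C.toNNReal (fun s => (σ s : V)) _ from hL.lipschitzOnWith)
        fun _ h => h
    refine ⟨max 1 (K' * C.toNNReal), _, mem_nhdsWithin_of_mem_nhds ht', ?_⟩
    have h2 := (LipschitzWith.id.lipschitzOnWith (s := (fun s => (σ s : V)) ⁻¹' t)).prodMk h1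
    have h3 : extChartAt (𝓘(ℝ, ℝ).prod (𝓡 n)) (s, σ s) ∘ (fun t => (t, σ t)) =
        fun r => (id r, F (σ r)) := by
      funext r
      simp only [Function.comp_apply, extChartAt_prod, PartialEquiv.prod_coe, ← hF]
      rfl
    rw [h3]
    exact h2
  futureCausal := by
    have hL : LipschitzWith C.toNNReal fun s => (σ s : V) :=
      lipschitzWith_of_mem_speedLimitCurves hC hσ
    filter_upwards [ae_restrict_of_ae hL.ae_differentiableAt] with s hs
    have h1 : MDifferentiableAt 𝓘(ℝ, ℝ) (𝓘(ℝ, ℝ).prod (𝓡 n)) (fun t => (t, σ t)) s :=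
      mdifferentiableAt_id.prodMk (mdifferentiableAt_sphere_of_coe hs.mdifferentiableAt)
    refine ⟨h1, (futureCausal_velocity_iff hw h1).2 ?_⟩
    have h2 : deriv (fun s : ℝ => s) s = 1 := deriv_id s
    simp only [h2, mul_one, zero_lt_one, true_and]
    exact norm_deriv_le_of_mem_speedLimitCurves hσ hs

theorem mem_causalFuture_warpedMetric_iff [FiniteDimensional ℝ V] (hw : ∀ x, 0 < w x)
    (hC : ∀ x, w x ≤ C) (hK : LipschitzWith K w) {p q : ℝ × Metric.sphere (0 : V) 1} :
    q ∈ causalFuture (𝓘(ℝ, ℝ).prod (𝓡 n)) (warpedMetric n w) (timeDirection (𝓡 n) _) p ↔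
      p.1 ≤ q.1 ∧ ∃ σ ∈ speedLimitCurves w C (K * C), σ p.1 = p.2 ∧ σ q.1 = q.2 := by
  refine ⟨exists_speedLimitCurve_of_mem_causalFuture hw hC hK, ?_⟩
  rintro ⟨hpq, σ, hσ, h1, h2⟩
  rcases hpq.eq_or_lt with h | h
  · left
    exact Prod.ext h.symm (by rw [← h1, ← h2, h])
  · right
    exact ⟨_, p.1, q.1, isCausalCurveOn_of_mem_speedLimitCurves hw ((hw p.2).le.trans (hC _)) hσ h,
      Prod.ext rfl h1, Prod.ext rfl h2⟩

theorem stronglyCausal_warpedMetric (hw : ∀ x, 0 < w x) (hC : ∀ x, w x ≤ C) :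
    StronglyCausal (𝓘(ℝ, ℝ).prod (𝓡 n)) (warpedMetric n w) (timeDirection (𝓡 n) _) := by
  intro p U hU
  have hC0 : 0 ≤ C := (hw p.2).le.trans (hC _)
  obtain ⟨ε, hε, hεU⟩ := Metric.mem_nhds_iff.1 hU
  -- End points in the δ-ball span a time of at most 2δ, hence a displacement of at most 2Cδ from
  -- the initial point; δ + 2Cδ = ε.
  set δ := ε / (2 * C + 1) with hδ
  have hδ0 : 0 < δ := by positivity
  have hδε : δ * (2 * C + 1) = ε := div_mul_cancel₀ _ (by positivity)
  have hle : δ ≤ ε := by nlinarith [mul_nonneg hδ0.le hC0]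
  refine ⟨Metric.ball p δ, Metric.ball_mem_nhds _ hδ0, (Metric.ball_subset_ball hle).trans hεU, ?_⟩
  rintro γ a b hγ hγa hγb _ ⟨s, hs, rfl⟩
  refine hεU ?_
  have ha : a ∈ Icc a b := left_mem_Icc.2 hγ.lt.le
  have hb : b ∈ Icc a b := right_mem_Icc.2 hγ.lt.le
  have h1 : (γ a).1 ≤ (γ s).1 := hγ.monotoneOn hw ha hs hs.1
  have h2 : (γ s).1 ≤ (γ b).1 := hγ.monotoneOn hw hs hb hs.2
  have h3 := hγ.norm_sub_le_of_le hw hC ha hs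
  rw [Metric.mem_ball, Prod.dist_eq, max_lt_iff, Real.dist_eq, abs_lt] at hγa hγb ⊢
  rw [abs_of_nonneg (sub_nonneg.2 h1)] at h3
  refine ⟨⟨by linarith, by linarith⟩, ?_⟩
  have h4 : C * ((γ s).1 - (γ a).1) ≤ C * (2 * δ) := by gcongr; linarith
  have h5 := dist_triangle (γ s).2 (γ a).2 p.2
  have h6 : dist (γ s).2 (γ a).2 ≤ C * (2 * δ) := by
    rw [Subtype.dist_eq, dist_eq_norm]
    exact h3.trans h4
  have h7 := hγa.2
  linarith

theorem globallyHyperbolic_warpedMetric [FiniteDimensional ℝ V] (hw : ∀ x, 0 < w x)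
    (hC : ∀ x, w x ≤ C) (hK : LipschitzWith K w) :
    GloballyHyperbolic (𝓘(ℝ, ℝ).prod (𝓡 n)) (warpedMetric n w) (timeDirection (𝓡 n) _) := by
  refine ⟨stronglyCausal_warpedMetric hw hC, fun p q => ?_⟩
  have hC0 : 0 ≤ C := (hw p.2).le.trans (hC _)
  -- The diamond is the intersection of the points reached by curves through p and by curves through
  -- q; the time interval [p.1, q.1] serves both.
  convert (isCompact_image_eval_speedLimitCurves hK.continuous hC0 (K * C) p.1 q.1 p.1 p.2).inter
    (isCompact_image_eval_speedLimitCurves hK.continuous hC0 (K * C) p.1 q.1 q.1 q.2) using 1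
  ext r
  simp only [causalPast, mem_inter_iff, mem_ofPred_eq, mem_causalFuture_warpedMetric_iff hw hC hK,
    mem_image, mem_prod, Prod.exists]
  constructor
  · rintro ⟨⟨h1, σ, hσ, h2, h3⟩, h4, σ', hσ', h5, h6⟩
    exact ⟨⟨r.1, σ, ⟨⟨h1, h4⟩, hσ, h2⟩, Prod.ext rfl h3⟩,
      ⟨r.1, σ', ⟨⟨h1, h4⟩, hσ', h6⟩, Prod.ext rfl h5⟩⟩
  · rintro ⟨⟨t, σ, ⟨h1, hσ, h2⟩, rfl⟩, ⟨t', σ', ⟨h3, hσ', h4⟩, h5⟩⟩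
    obtain ⟨rfl, h6⟩ := Prod.ext_iff.1 h5
    exact ⟨⟨h1.1, σ, hσ, h2, rfl⟩, h1.2, σ', hσ', h6, h4⟩

end GloballyHyperbolic

/-! ### The static spacetime ℝ × ℝ × S^m -/

section Static

instance fact_finrank_euclideanSpace_fin (m : ℕ) :
    Fact (Module.finrank ℝ (EuclideanSpace ℝ (Fin (m + 1))) = m + 1) :=
  ⟨finrank_euclideanSpace_fin⟩

variable {m : ℕ} {f : ℝ → ℝ}

theorem staticMetric_apply (p : Spc m) (u v : TangentSpace (SpcModel m) p) :
    staticMetric m f p u v =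
      -(f p.2.1 * (mvfderiv (SpcModel m) (fun q : Spc m => q.1) p u *
        mvfderiv (SpcModel m) (fun q : Spc m => q.1) p v)) +
      ((f p.2.1)⁻¹ * (mvfderiv (SpcModel m) (fun q : Spc m => q.2.1) p u *
        mvfderiv (SpcModel m) (fun q : Spc m => q.2.1) p v) +
      inner ℝ (mvfderiv (SpcModel m) (fun q : Spc m => (q.2.2 : EuclideanSpace ℝ (Fin (m + 1)))) p u)
        (mvfderiv (SpcModel m)
          (fun q : Spc m => (q.2.2 : EuclideanSpace ℝ (Fin (m + 1)))) p v)) := by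
  change -(f p.2.1 * pullbackInner _ _ p u v) + (f p.2.1)⁻¹ * pullbackInner _ _ p u v +
    pullbackInner _ _ p u v = _
  rw [pullbackInner_apply, pullbackInner_apply, pullbackInner_apply, Real.inner_apply,
    Real.inner_apply, add_assoc]

theorem contMDiff_snd_fst : ContMDiff (SpcModel m) 𝓘(ℝ, ℝ) ∞ (fun q : Spc m => q.2.1) :=
  contMDiff_fst.comp contMDiff_snd

theorem contMDiff_coe_snd_snd : ContMDiff (SpcModel m) 𝓘(ℝ, EuclideanSpace ℝ (Fin (m + 1))) ∞
    (fun q : Spc m => (q.2.2 : EuclideanSpace ℝ (Fin (m + 1)))) :=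
  contMDiff_coe_sphere.comp (contMDiff_snd.comp contMDiff_snd)

theorem isSmoothMetric_staticMetric (hf : ContDiff ℝ ∞ f) (hpos : ∀ r, 0 < f r) :
    IsSmoothMetric (SpcModel m) (staticMetric m f) := by
  have h1 : ContMDiff (SpcModel m) 𝓘(ℝ, ℝ) ∞ (fun q : Spc m => f q.2.1) :=
    hf.contMDiff.comp contMDiff_snd_fst
  have h2 : ContMDiff (SpcModel m) 𝓘(ℝ, ℝ) ∞ (fun q : Spc m => (f q.2.1)⁻¹) :=
    (hf.inv fun r => (hpos r).ne').contMDiff.comp contMDiff_snd_fst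
  exact (((isSmoothMetric_pullbackInner contMDiff_fst).smul h1).neg.add
    ((isSmoothMetric_pullbackInner contMDiff_snd_fst).smul h2)).add
    (isSmoothMetric_pullbackInner contMDiff_coe_snd_snd)

theorem mvfderiv_fst_timeField (p : Spc m) :
    mvfderiv (SpcModel m) (fun q : Spc m => q.1) p (timeField m p) = 1 :=
  mvfderiv_fst_timeDirection p

theorem mvfderiv_snd_fst_timeField (p : Spc m) :
    mvfderiv (SpcModel m) (fun q : Spc m => q.2.1) p (timeField m p) = 0 :=
  mvfderiv_comp_snd_timeDirection (φ := fun q : ℝ × Sph m => q.1) p mdifferentiableAt_fst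

theorem mvfderiv_snd_snd_timeField (p : Spc m) :
    mvfderiv (SpcModel m) (fun q : Spc m => (q.2.2 : EuclideanSpace ℝ (Fin (m + 1)))) p
      (timeField m p) = 0 :=
  mvfderiv_comp_snd_timeDirection
    (φ := fun q : ℝ × Sph m => (q.2 : EuclideanSpace ℝ (Fin (m + 1)))) p
    (contMDiff_coe_snd_warped.mdifferentiable (by simp) _)

theorem isSpacetime_staticMetric (hm : 1 ≤ m) (hpos : ∀ r, 0 < f r) :
    IsSpacetime (SpcModel m) (m + 1) (staticMetric m f) (timeField m) where
  finrank_eq := by simp; ring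
  boundaryless := inferInstance
  t2 := inferInstance
  secondCountable := inferInstance
  connected := by
    -- Here n ≥ 2 enters: S⁰ is disconnected.
    have : ConnectedSpace (Sph m) := connectedSpace_sphere hm
    infer_instance
  lorentz p := by
    refine isLorentzForm_of_eq (A := f p.2.1) (T := timeField m p) (hpos _)
      (staticMetric_apply p) (fun v w => ?_) (mvfderiv_fst_timeField p) (fun u => ?_)
      (fun u h1 h2 => ?_)
    · rw [real_inner_comm, mul_comm (mvfderiv _ _ p v)]
    · rw [mvfderiv_snd_fst_timeField, mvfderiv_snd_snd_timeField, inner_zero_left]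
      simp
    · rw [real_inner_self_eq_norm_sq]
      have h3 := (mvfderiv_comp_fst (φ := fun s : ℝ => s) mdifferentiableAt_id u).symm.trans h1
      have h3' : u.1 = 0 := (mvfderiv_id_real _ _).symm.trans h3
      set a := mvfderiv (SpcModel m) (fun q : Spc m => q.2.1) p u with ha
      set b := mvfderiv (SpcModel m) (fun q : Spc m => (q.2.2 : EuclideanSpace ℝ (Fin (m + 1)))) p u
        with hb
      have hf := inv_pos.2 (hpos p.2.1)
      by_contra hcon
      have h4 : 0 ≤ (f p.2.1)⁻¹ * (a * a) := mul_nonneg hf.le (mul_self_nonneg a)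
      have h5 : 0 ≤ ‖b‖ ^ 2 := sq_nonneg _
      have ha0 : a = 0 := mul_self_eq_zero.1
        ((mul_eq_zero.1 (by linarith : (f p.2.1)⁻¹ * (a * a) = 0)).resolve_left hf.ne')
      have hb0 : b = 0 := norm_eq_zero.1 (pow_eq_zero_iff two_ne_zero |>.1 (by linarith))
      have h6 := (mvfderiv_comp_snd (φ := fun q : ℝ × Sph m => q.1) (p := p)
        mdifferentiableAt_fst u).symm.trans (ha.symm.trans ha0)
      have h7 := (mvfderiv_comp_snd
        (φ := fun q : ℝ × Sph m => (q.2 : EuclideanSpace ℝ (Fin (m + 1)))) (p := p)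
        (contMDiff_coe_snd_warped.mdifferentiable (by simp) _) u).symm.trans (hb.symm.trans hb0)
      have h8 := (mvfderiv_comp_fst (φ := fun s : ℝ => s) (p := p.2)
        mdifferentiableAt_id u.2).symm.trans h6
      have h9 := (mvfderiv_comp_snd (p := p.2)
        (mdifferentiableAt_coe_sphere p.2.2) u.2).symm.trans h7
      exact h2 (Prod.ext h3' (Prod.ext ((mvfderiv_id_real _ _).symm.trans h8)
        (eq_zero_of_mvfderiv_coe_sphere h9)))
  timelike p := by
    rw [staticMetric_apply, mvfderiv_fst_timeField, mvfderiv_snd_fst_timeField,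
      mvfderiv_snd_snd_timeField, inner_zero_left]
    have := hpos p.2.1
    linarith
  continuous_timeOrientation := continuous_timeDirection

end Static

/-! ### The sphere S^(m+1) in polar form and its latitude -/

section Polar

variable {m : ℕ}

/-- The Euclidean space `ℝ × ℝ^{m+1}`, whose unit sphere is written in polar coordinates. -/
abbrev PolarSpace (m : ℕ) : Type := WithLp 2 (ℝ × EuclideanSpace ℝ (Fin (m + 1)))

instance fact_finrank_polarSpace (m : ℕ) :
    Fact (Module.finrank ℝ (PolarSpace m) = (m + 1) + 1) :=
  ⟨by rw [(WithLp.linearEquiv 2 ℝ (ℝ × EuclideanSpace ℝ (Fin (m + 1)))).finrank_eq]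
      simp [add_comm]⟩

/-- The unit sphere `S^{m+1}` in `ℝ × ℝ^{m+1}`. -/
abbrev PolarSphere (m : ℕ) : Type := Metric.sphere (0 : PolarSpace m) 1

theorem PolarSphere.sq_add_sq (x : PolarSphere m) :
    x.1.fst ^ 2 + ‖x.1.snd‖ ^ 2 = 1 := by
  have h := WithLp.prod_norm_sq_eq_of_L2 x.1
  rw [norm_eq_of_mem_sphere, Real.norm_eq_abs, sq_abs] at h
  linarith

theorem contDiff_polarSpace_fst : ContDiff ℝ ∞ (fun x : PolarSpace m => x.fst) :=
  (WithLp.fstL 2 ℝ ℝ (EuclideanSpace ℝ (Fin (m + 1)))).contDiff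

theorem contDiff_polarSpace_snd : ContDiff ℝ ∞ (fun x : PolarSpace m => x.snd) :=
  (WithLp.sndL 2 ℝ ℝ (EuclideanSpace ℝ (Fin (m + 1)))).contDiff

theorem contDiff_polarSpace_toLp : ContDiff ℝ ∞
    (fun x : ℝ × EuclideanSpace ℝ (Fin (m + 1)) => (WithLp.toLp 2 x : PolarSpace m)) :=
  (WithLp.prodContinuousLinearEquiv 2 ℝ ℝ (EuclideanSpace ℝ (Fin (m + 1)))).symm.contDiff

theorem polar_mem_sphere {a b : ℝ} (h : a ^ 2 + b ^ 2 = 1) (θ : Sph m) :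
    (WithLp.toLp 2 (a, b • (θ : EuclideanSpace ℝ (Fin (m + 1)))) : PolarSpace m) ∈
      Metric.sphere (0 : PolarSpace m) 1 := by
  rw [mem_sphere_zero_iff_norm, ← sq_eq_sq₀ (norm_nonneg _) zero_le_one,
    WithLp.prod_norm_sq_eq_of_L2]
  simp only [WithLp.toLp_fst, WithLp.toLp_snd, norm_smul, norm_eq_of_mem_sphere, mul_one,
    Real.norm_eq_abs, sq_abs, h, one_pow]

theorem tanh_sq_add_inv_cosh_sq (s : ℝ) : Real.tanh s ^ 2 + (Real.cosh s)⁻¹ ^ 2 = 1 := by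
  have := (Real.cosh_pos s).ne'
  rw [Real.tanh_eq_sinh_div_cosh]
  field_simp
  linarith [Real.cosh_sq s]

/-- The conformal map from the cylinder `ℝ × S^m` to the sphere `S^{m+1}`. -/
noncomputable def cylinderToSphere (s : ℝ) (θ : Sph m) : PolarSphere m :=
  ⟨WithLp.toLp 2 (Real.tanh s, (Real.cosh s)⁻¹ • (θ : EuclideanSpace ℝ (Fin (m + 1)))),
    polar_mem_sphere (tanh_sq_add_inv_cosh_sq s) θ⟩

theorem norm_snd_cylinderToSphere (s : ℝ) (θ : Sph m) :
    ‖(cylinderToSphere s θ).1.snd‖ = (Real.cosh s)⁻¹ := by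
  simp only [cylinderToSphere, WithLp.toLp_snd, norm_smul, norm_eq_of_mem_sphere, mul_one,
    norm_inv, Real.norm_eq_abs, abs_of_pos (Real.cosh_pos s)]

/-- The unit vector in the direction of `y`, with the default value `ω₀` at `y = 0`. -/
noncomputable def direction (ω₀ : Sph m) (y : EuclideanSpace ℝ (Fin (m + 1))) : Sph m :=
  open Classical in
  if h : y = 0 then ω₀ else ⟨‖y‖⁻¹ • y, by
    rw [mem_sphere_zero_iff_norm, norm_smul, norm_inv, norm_norm,
      inv_mul_cancel₀ (norm_ne_zero_iff.2 h)]⟩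

theorem coe_direction (ω₀ : Sph m) {y : EuclideanSpace ℝ (Fin (m + 1))} (h : y ≠ 0) :
    (direction ω₀ y : EuclideanSpace ℝ (Fin (m + 1))) = ‖y‖⁻¹ • y := by
  simp [direction, h]

/-- The logarithmic radial coordinate on the sphere, the inverse of `cylinderToSphere`. -/
noncomputable def sphereRadius (x : PolarSphere m) : ℝ := Real.arsinh (x.1.fst / ‖x.1.snd‖)

theorem sphereRadius_cylinderToSphere (s : ℝ) (θ : Sph m) :
    sphereRadius (cylinderToSphere s θ) = s := by
  rw [sphereRadius, norm_snd_cylinderToSphere]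
  simp only [cylinderToSphere, WithLp.toLp_fst, Real.tanh_eq_sinh_div_cosh, div_inv_eq_mul]
  rw [div_mul_cancel₀ _ (Real.cosh_pos s).ne', Real.arsinh_sinh]

theorem direction_cylinderToSphere (ω₀ : Sph m) (s : ℝ) (θ : Sph m) :
    direction ω₀ (cylinderToSphere s θ).1.snd = θ := by
  have h : (cylinderToSphere s θ).1.snd ≠ 0 := by
    rw [← norm_ne_zero_iff, norm_snd_cylinderToSphere]
    exact inv_ne_zero (Real.cosh_pos s).ne'
  apply Subtype.ext
  rw [coe_direction ω₀ h, norm_snd_cylinderToSphere, inv_inv]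
  simp only [cylinderToSphere, WithLp.toLp_snd]
  rw [smul_inv_smul₀ (Real.cosh_pos s).ne']

theorem cylinderToSphere_sphereRadius (ω₀ : Sph m) {x : PolarSphere m} (hx : x.1.snd ≠ 0) :
    cylinderToSphere (sphereRadius x) (direction ω₀ x.1.snd) = x := by
  have h0 : 0 < ‖x.1.snd‖ := norm_pos_iff.2 hx
  have hc : Real.cosh (sphereRadius x) = ‖x.1.snd‖⁻¹ := by
    have h1 : 1 + (x.1.fst / ‖x.1.snd‖) ^ 2 = (‖x.1.snd‖⁻¹) ^ 2 := by
      field_simp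
      linarith [x.sq_add_sq]
    rw [sphereRadius, Real.cosh_arsinh, h1, Real.sqrt_sq (inv_nonneg.2 h0.le)]
  apply Subtype.ext
  apply (WithLp.equiv 2 _).injective
  apply Prod.ext
  · change Real.tanh _ = x.1.fst
    rw [Real.tanh_eq_sinh_div_cosh, hc, sphereRadius, Real.sinh_arsinh, div_inv_eq_mul,
      div_mul_cancel₀ _ h0.ne']
  · change (Real.cosh _)⁻¹ • ((direction ω₀ x.1.snd : Sph m) : EuclideanSpace ℝ _) = x.1.snd
    rw [hc, inv_inv, coe_direction ω₀ hx, smul_inv_smul₀ h0.ne']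

/-- The latitude is the Gudermannian of the cylinder coordinate, the variable in which the lapse was
extended; this carries `W` over to the sphere. -/
theorem arcsin_fst_cylinderToSphere (s : ℝ) (θ : Sph m) :
    Real.arcsin (cylinderToSphere s θ).1.fst = Real.arctan (Real.sinh s) := by
  rw [Real.arctan_eq_arcsin, ← Real.cosh_sq', Real.sqrt_sq (Real.cosh_pos s).le,
    ← Real.tanh_eq_sinh_div_cosh]
  rfl

/-- Although arcsin is not Lipschitz at ±1, the latitude is: by the reverse triangle inequality the
chord is no shorter than that between points of the same latitudes on one meridian, which is 2
sin(|α - β|/2), and Jordan's inequality bounds this below. -/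
theorem abs_arcsin_sub_arcsin_le (x y : PolarSphere m) :
    |Real.arcsin x.1.fst - Real.arcsin y.1.fst| ≤ Real.pi / 2 * ‖(x : PolarSpace m) - y‖ := by
  have hx := x.sq_add_sq
  have hy := y.sq_add_sq
  have hb : ∀ z : PolarSphere m, -1 ≤ z.1.fst ∧ z.1.fst ≤ 1 := fun z =>
    abs_le.1 ((sq_le_one_iff_abs_le_one _).1 (by nlinarith [z.sq_add_sq, sq_nonneg ‖z.1.snd‖]))
  set α := Real.arcsin x.1.fst with hα
  set β := Real.arcsin y.1.fst with hβ
  have sα : Real.sin α = x.1.fst := Real.sin_arcsin (hb x).1 (hb x).2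
  have sβ : Real.sin β = y.1.fst := Real.sin_arcsin (hb y).1 (hb y).2
  have cα : Real.cos α = ‖x.1.snd‖ := by
    rw [hα, Real.cos_arcsin, ← eq_sub_of_add_eq' hx, Real.sqrt_sq (norm_nonneg _)]
  have cβ : Real.cos β = ‖y.1.snd‖ := by
    rw [hβ, Real.cos_arcsin, ← eq_sub_of_add_eq' hy, Real.sqrt_sq (norm_nonneg _)]
  have hd : ‖(x : PolarSpace m) - y‖ ^ 2 = (x.1.fst - y.1.fst) ^ 2 + ‖x.1.snd - y.1.snd‖ ^ 2 := by
    rw [WithLp.prod_norm_sq_eq_of_L2, WithLp.sub_fst, WithLp.sub_snd, Real.norm_eq_abs, sq_abs]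
  have hn : (‖x.1.snd‖ - ‖y.1.snd‖) ^ 2 ≤ ‖x.1.snd - y.1.snd‖ ^ 2 :=
    sq_le_sq.2 (by rw [abs_of_nonneg (norm_nonneg (x.1.snd - y.1.snd))]; exact abs_norm_sub_norm_le _ _)
  have hchord : (2 * Real.sin (|α - β| / 2)) ^ 2 ≤ ‖(x : PolarSpace m) - y‖ ^ 2 := by
    have h1 : (2 * Real.sin (|α - β| / 2)) ^ 2 = 2 - 2 * Real.cos (α - β) := by
      have h2 := Real.cos_sq' (|α - β| / 2)
      have h3 := Real.cos_two_mul (|α - β| / 2)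
      rw [mul_div_cancel₀ _ two_ne_zero, Real.cos_abs] at h3
      nlinarith
    rw [h1, Real.cos_sub, cα, cβ, sα, sβ, hd]
    nlinarith
  have hπ : |α - β| / 2 ≤ Real.pi / 2 := by
    have h1 := Real.arcsin_mem_Icc x.1.fst
    have h2 := Real.arcsin_mem_Icc y.1.fst
    rw [← hα] at h1
    rw [← hβ] at h2
    have : |α - β| ≤ Real.pi := abs_le.2 ⟨by linarith [h1.1, h2.2], by linarith [h1.2, h2.1]⟩
    linarith
  have hs := Real.mul_le_sin (by positivity) hπ
  have h4 : 2 * Real.sin (|α - β| / 2) ≤ ‖(x : PolarSpace m) - y‖ :=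
    le_of_sq_le_sq hchord (norm_nonneg _)
  have hpi := Real.pi_pos
  have h5 : 2 / Real.pi * |α - β| ≤ ‖(x : PolarSpace m) - y‖ := by linarith
  rw [div_mul_eq_mul_div, div_le_iff₀ hpi] at h5
  linarith

theorem lipschitzWith_comp_arcsin {W : ℝ → ℝ} {K : NNReal} (hW : LipschitzWith K W) :
    ∃ K' : NNReal, LipschitzWith K' fun x : PolarSphere m => W (Real.arcsin x.1.fst) := by
  have h : LipschitzWith (Real.pi / 2).toNNReal fun x : PolarSphere m => Real.arcsin x.1.fst :=
    LipschitzWith.of_dist_le_mul fun x y => by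
      rw [Real.dist_eq, Subtype.dist_eq, dist_eq_norm,
        Real.coe_toNNReal _ (by positivity)]
      exact abs_arcsin_sub_arcsin_le x y
  exact ⟨_, hW.comp h⟩

end Polar

/-! ### The embedding into ℝ × S^(m+1), its boundary and the end curves -/

section Embedding

variable {m : ℕ}

theorem exists_contDiff_inverse {ρ ρ' : ℝ → ℝ} (hs : ContDiff ℝ ∞ ρ)
    (hd : ∀ r, HasDerivAt ρ (ρ' r) r) (hpos : ∀ r, 0 < ρ' r) (ht : Tendsto ρ atTop atTop)
    (hb : Tendsto ρ atBot atBot) :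
    ∃ R : ℝ → ℝ, ContDiff ℝ ∞ R ∧ (∀ r, R (ρ r) = r) ∧ ∀ s, ρ (R s) = s := by
  have hm : StrictMono ρ := strictMono_of_deriv_pos fun r => by rw [(hd r).deriv]; exact hpos r
  have hsurj : Function.Surjective ρ := hs.continuous.surjective ht hb
  set e := hm.orderIsoOfSurjective ρ hsurj with he
  refine ⟨e.symm, ?_, fun r => e.symm_apply_apply r, fun s => e.apply_symm_apply s⟩
  exact e.toHomeomorph.contDiff_symm_deriv (f' := ρ') (fun x => (hpos x).ne') hd hs

/-- The map `(t, r, θ) ↦ (t, x)` from `ℝ × ℝ × S^m` to `ℝ × S^{m+1}` given by a radial coordinate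
`ρ(r)` and the conformal map from the cylinder to the sphere. -/
noncomputable def cylinderEmbedding (ρ : ℝ → ℝ) (p : Spc m) : ℝ × PolarSphere m :=
  (p.1, cylinderToSphere (ρ p.2.1) p.2.2)

/-- The inverse of `cylinderEmbedding`, where `R` is the inverse of `ρ`. -/
noncomputable def cylinderEmbeddingInv (R : ℝ → ℝ) (ω₀ : Sph m) (q : ℝ × PolarSphere m) : Spc m :=
  (q.1, R (sphereRadius q.2), direction ω₀ q.2.1.snd)

theorem cylinderEmbeddingInv_cylinderEmbedding {ρ R : ℝ → ℝ} (h : ∀ r, R (ρ r) = r)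
    (ω₀ : Sph m) (p : Spc m) : cylinderEmbeddingInv R ω₀ (cylinderEmbedding ρ p) = p := by
  simp only [cylinderEmbeddingInv, cylinderEmbedding, sphereRadius_cylinderToSphere, h,
    direction_cylinderToSphere]

theorem cylinderEmbedding_cylinderEmbeddingInv {ρ R : ℝ → ℝ} (h : ∀ s, ρ (R s) = s)
    (ω₀ : Sph m) {q : ℝ × PolarSphere m} (hq : q.2.1.snd ≠ 0) :
    cylinderEmbedding ρ (cylinderEmbeddingInv R ω₀ q) = q := by
  simp only [cylinderEmbeddingInv, cylinderEmbedding, h, cylinderToSphere_sphereRadius ω₀ hq]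

theorem snd_cylinderEmbedding_ne_zero (ρ : ℝ → ℝ) (p : Spc m) :
    (cylinderEmbedding ρ p).2.1.snd ≠ 0 := by
  rw [← norm_ne_zero_iff, cylinderEmbedding, norm_snd_cylinderToSphere]
  exact inv_ne_zero (Real.cosh_pos _).ne'

theorem range_cylinderEmbedding {ρ R : ℝ → ℝ} (h : ∀ s, ρ (R s) = s) (ω₀ : Sph m) :
    range (cylinderEmbedding (m := m) ρ) = {q | q.2.1.snd ≠ 0} := by
  ext q
  constructor
  · rintro ⟨p, rfl⟩
    exact snd_cylinderEmbedding_ne_zero ρ p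
  · exact fun hq => ⟨_, cylinderEmbedding_cylinderEmbeddingInv h ω₀ hq⟩

theorem isOpen_snd_ne_zero : IsOpen {q : ℝ × PolarSphere m | q.2.1.snd ≠ 0} :=
  isOpen_ne_fun (contDiff_polarSpace_snd.continuous.comp
    (continuous_subtype_val.comp continuous_snd)) continuous_const

theorem contMDiff_coe_cylinderEmbedding {ρ : ℝ → ℝ} (hρ : ContDiff ℝ ∞ ρ) :
    ContMDiff (SpcModel m) 𝓘(ℝ, PolarSpace m) ∞
      (fun p : Spc m => ((cylinderEmbedding ρ p).2 : PolarSpace m)) := by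
  have h1 : ContDiff ℝ ∞ fun x : ℝ × EuclideanSpace ℝ (Fin (m + 1)) =>
      (Real.tanh (ρ x.1), (Real.cosh (ρ x.1))⁻¹ • x.2) := by
    have h2 : ContDiff ℝ ∞ fun x : ℝ × EuclideanSpace ℝ (Fin (m + 1)) => ρ x.1 :=
      hρ.comp contDiff_fst
    simp only [Real.tanh_eq_sinh_div_cosh]
    have h3 := h2.cosh
    exact (h2.sinh.div h3 fun x => (Real.cosh_pos _).ne').prodMk
      ((h3.inv fun x => (Real.cosh_pos _).ne').smul contDiff_snd)
  have h4 : ContDiff ℝ ∞ fun x : ℝ × EuclideanSpace ℝ (Fin (m + 1)) =>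
      (WithLp.toLp 2 (Real.tanh (ρ x.1), (Real.cosh (ρ x.1))⁻¹ • x.2) : PolarSpace m) :=
    contDiff_polarSpace_toLp.comp h1
  have h5 : ContMDiff (SpcModel m) 𝓘(ℝ, ℝ × EuclideanSpace ℝ (Fin (m + 1))) ∞
      fun p : Spc m => (p.2.1, (p.2.2 : EuclideanSpace ℝ (Fin (m + 1)))) :=
    contMDiff_snd_fst.prodMk_space contMDiff_coe_snd_snd
  have h6 := h4.contMDiff.comp h5
  exact h6

theorem contMDiff_cylinderEmbedding {ρ : ℝ → ℝ} (hρ : ContDiff ℝ ∞ ρ) :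
    ContMDiff (SpcModel m) (𝓘(ℝ, ℝ).prod (𝓡 (m + 1))) ∞ (cylinderEmbedding (m := m) ρ) :=
  contMDiff_fst.prodMk fun p => contMDiffWithinAt_sphere_of_coe
    ((contMDiff_coe_cylinderEmbedding hρ) p).contMDiffWithinAt

theorem contMDiffOn_cylinderEmbeddingInv {R : ℝ → ℝ} (hR : ContDiff ℝ ∞ R) (ω₀ : Sph m) :
    ContMDiffOn (𝓘(ℝ, ℝ).prod (𝓡 (m + 1))) (SpcModel m) ∞ (cylinderEmbeddingInv R ω₀)
      {q : ℝ × PolarSphere m | q.2.1.snd ≠ 0} := by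
  have hcoe : ContMDiff (𝓘(ℝ, ℝ).prod (𝓡 (m + 1))) 𝓘(ℝ, PolarSpace m) ∞
    (fun q : ℝ × PolarSphere m => (q.2 : PolarSpace m)) := contMDiff_coe_snd_warped
  have hmaps : MapsTo (fun q : ℝ × PolarSphere m => (q.2 : PolarSpace m)) {q | q.2.1.snd ≠ 0}
    {x | x.snd ≠ 0} := fun q hq => hq
  have hn : ContDiffOn ℝ ∞ (fun x : PolarSpace m => ‖x.snd‖) {x | x.snd ≠ 0} :=
    contDiff_polarSpace_snd.contDiffOn.norm ℝ fun x hx => hx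
  have h1 : ContDiffOn ℝ ∞ (fun x : PolarSpace m => R (Real.arsinh (x.fst / ‖x.snd‖)))
      {x | x.snd ≠ 0} :=
    (hR.comp Real.contDiff_arsinh).comp_contDiffOn
      (contDiff_polarSpace_fst.contDiffOn.div hn fun x hx => norm_ne_zero_iff.2 hx)
  have h2 : ContDiffOn ℝ ∞ (fun x : PolarSpace m => ‖x.snd‖⁻¹ • x.snd) {x | x.snd ≠ 0} :=
    (hn.inv fun x hx => norm_ne_zero_iff.2 hx).smul contDiff_polarSpace_snd.contDiffOn
  refine contMDiff_fst.contMDiffOn.prodMk (ContMDiffOn.prodMk ?_ fun q hq => ?_)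
  · exact h1.contMDiffOn.comp hcoe.contMDiffOn hmaps
  · refine contMDiffWithinAt_sphere_of_coe ?_
    refine ((h2.contMDiffOn.comp hcoe.contMDiffOn hmaps) q hq).congr (fun q hq => ?_) ?_
    · exact coe_direction ω₀ hq
    · exact coe_direction ω₀ hq

theorem isLocalDiffeomorph_cylinderEmbedding {ρ R : ℝ → ℝ} (hρ : ContDiff ℝ ∞ ρ)
    (hR : ContDiff ℝ ∞ R) (h1 : ∀ r, R (ρ r) = r) (h2 : ∀ s, ρ (R s) = s) :
    IsLocalDiffeomorph (SpcModel m) (𝓘(ℝ, ℝ).prod (𝓡 (m + 1))) ∞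
      (cylinderEmbedding (m := m) ρ) := fun p =>
  ⟨{ toFun := cylinderEmbedding ρ
     invFun := cylinderEmbeddingInv R p.2.2
     source := univ
     target := {q | q.2.1.snd ≠ 0}
     map_source' := fun p _ => snd_cylinderEmbedding_ne_zero ρ p
     map_target' := fun _ _ => mem_univ _
     left_inv' := fun p' _ => cylinderEmbeddingInv_cylinderEmbedding h1 p.2.2 p'
     right_inv' := fun _ hq => cylinderEmbedding_cylinderEmbeddingInv h2 p.2.2 hq
     open_source := isOpen_univ
     open_target := isOpen_snd_ne_zero
     contMDiffOn_toFun := (contMDiff_cylinderEmbedding hρ).contMDiffOn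
     contMDiffOn_invFun := contMDiffOn_cylinderEmbeddingInv hR p.2.2 }, mem_univ _, fun _ _ => rfl⟩

/-- The poles `(ε, 0)`, `ε = ± 1`, of the sphere. -/
noncomputable def pole (m : ℕ) (ε : ℝ) (hε : ε ^ 2 = 1) : PolarSphere m :=
  ⟨WithLp.toLp 2 (ε, 0), by
    rw [mem_sphere_zero_iff_norm, ← sq_eq_sq₀ (norm_nonneg _) zero_le_one,
      WithLp.prod_norm_sq_eq_of_L2]
    simp [hε]⟩

theorem eq_pole {x : PolarSphere m} (hx : x.1.snd = 0) {ε : ℝ} (hε : ε ^ 2 = 1)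
    (h : x.1.fst = ε) : x = pole m ε hε := by
  apply Subtype.ext
  apply (WithLp.equiv 2 _).injective
  exact Prod.ext h hx

theorem fst_eq_one_or_of_snd_eq_zero {x : PolarSphere m} (hx : x.1.snd = 0) :
    x.1.fst = 1 ∨ x.1.fst = -1 := by
  have h := x.sq_add_sq
  rw [hx, norm_zero] at h
  have h' : (x.1.fst - 1) * (x.1.fst + 1) = 0 := by linear_combination h
  exact (mul_eq_zero.1 h').imp sub_eq_zero.1 eq_neg_of_add_eq_zero_left

/-- A pole is the limit along a great circle through it, s ↦ (ε cos s, sin s · ω₀) as s → 0⁺. -/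
theorem closure_snd_ne_zero (ω₀ : Sph m) :
    closure {q : ℝ × PolarSphere m | q.2.1.snd ≠ 0} = univ := by
  refine eq_univ_of_forall fun q => ?_
  by_cases hq : q.2.1.snd = 0
  · have hε : q.2.1.fst ^ 2 = 1 := by
      have h := q.2.sq_add_sq
      rw [hq, norm_zero] at h
      linarith
    set ε := q.2.1.fst with hεdef
    have hmem : ∀ s : ℝ, (ε * Real.cos s) ^ 2 + Real.sin s ^ 2 = 1 := fun s => by
      rw [mul_pow, hε, one_mul, Real.cos_sq_add_sin_sq]
    let c : ℝ → ℝ × PolarSphere m := fun s => (q.1, ⟨_, polar_mem_sphere (hmem s) ω₀⟩)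
    have hc : Continuous c := by
      refine continuous_const.prodMk (Continuous.subtype_mk ?_ _)
      exact contDiff_polarSpace_toLp.continuous.comp (by fun_prop)
    have hc0 : c 0 = q := by
      refine Prod.ext rfl ?_
      rw [eq_pole hq hε rfl]
      apply Subtype.ext
      simp [c, pole]
    rw [← hc0]
    refine mem_closure_of_tendsto ((hc.tendsto 0).mono_left
      (nhdsWithin_le_nhds (s := Ioi 0))) ?_
    filter_upwards [Ioo_mem_nhdsGT Real.pi_pos] with s hs
    refine smul_ne_zero (Real.sin_pos_of_mem_Ioo hs).ne' ?_
    exact ne_zero_of_mem_unit_sphere ω₀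
  · exact subset_closure hq

theorem frontier_range_cylinderEmbedding {ρ R : ℝ → ℝ} (h : ∀ s, ρ (R s) = s) (ω₀ : Sph m) :
    frontier (range (cylinderEmbedding (m := m) ρ)) = {q | q.2.1.snd = 0} := by
  rw [range_cylinderEmbedding h ω₀, frontier, closure_snd_ne_zero ω₀,
    isOpen_snd_ne_zero.interior_eq]
  ext q
  simp

/-- The two curves `t ↦ (t, ± pole)` bounding the image of `cylinderEmbedding`. -/
noncomputable def endCurve (m : ℕ) (i : {i : ℕ // (i : ℕ∞) < 2}) (t : ℝ) : ℝ × PolarSphere m :=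
  (t, pole m ((-1) ^ i.1) (by rw [← pow_mul, mul_comm, pow_mul]; simp))

theorem iUnion_range_endCurve : ⋃ i, range (endCurve m i) = {q | q.2.1.snd = 0} := by
  ext q
  simp only [mem_iUnion, mem_range, mem_ofPred_eq]
  constructor
  · rintro ⟨i, t, rfl⟩
    rfl
  · intro hq
    rcases fst_eq_one_or_of_snd_eq_zero hq with h | h
    · exact ⟨⟨0, by norm_num⟩, q.1, Prod.ext rfl (eq_pole hq (by norm_num) (by simpa using h)).symm⟩
    · exact ⟨⟨1, by norm_num⟩, q.1, Prod.ext rfl (eq_pole hq (by norm_num) (by simpa using h)).symm⟩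

theorem pairwise_disjoint_range_endCurve :
    Pairwise fun i₁ i₂ => Disjoint (range (endCurve m i₁)) (range (endCurve m i₂)) := by
  rintro ⟨i, hi⟩ ⟨j, hj⟩ hij
  rw [Set.disjoint_left]
  rintro _ ⟨t, rfl⟩ ⟨t', h⟩
  have h1 : ((-1 : ℝ)) ^ j = (-1) ^ i :=
    congrArg (fun q : ℝ × PolarSphere m => q.2.1.fst) h
  have hi' : i < 2 := by exact_mod_cast hi
  have hj' : j < 2 := by exact_mod_cast hj
  have hne : i ≠ j := fun h => hij (Subtype.ext h)
  interval_cases i <;> interval_cases j <;> first | exact hne rfl | norm_num at h1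

theorem isInextendibleTimelikeCurve_const {V : Type*} [NormedAddCommGroup V]
    [InnerProductSpace ℝ V] [FiniteDimensional ℝ V] {n : ℕ} [Fact (Module.finrank ℝ V = n + 1)]
    (hn : 1 ≤ n) {w : Metric.sphere (0 : V) 1 → ℝ} (hw : ∀ x, 0 < w x)
    (x : Metric.sphere (0 : V) 1) :
    IsInextendibleTimelikeCurve (𝓘(ℝ, ℝ).prod (𝓡 n)) (warpedMetric n w)
      (timeDirection (𝓡 n) _) (fun t => (t, x)) where
  contMDiff := contMDiff_id.prodMk contMDiff_const
  -- The velocity of t ↦ (t, x) is `timeDirection` by definition, so both conditions are the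
  -- timelikeness of the time orientation.
  futureTimelike s :=
    ⟨(isSpacetime_warpedMetric hn hw).timelike (s, x),
      (isSpacetime_warpedMetric hn hw).timelike (s, x)⟩
  future_inextendible p h :=
    not_tendsto_nhds_of_tendsto_atTop tendsto_id _ ((continuous_fst.tendsto p).comp h)
  past_inextendible p h :=
    not_tendsto_nhds_of_tendsto_atBot tendsto_id _ ((continuous_fst.tendsto p).comp h)

end Embedding

/-! ### The conformal identity -/

section Conformal

theorem mvfderiv_comp_eq_fderiv {E : Type*} [NormedAddCommGroup E] [NormedSpace ℝ E]
    {H : Type*} [TopologicalSpace H] {I : ModelWithCorners ℝ E H}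
    {M : Type*} [TopologicalSpace M] [ChartedSpace H M]
    {V W : Type*} [NormedAddCommGroup V] [NormedSpace ℝ V] [NormedAddCommGroup W] [NormedSpace ℝ W]
    {φ : M → V} {F : V → W} {F' : V →L[ℝ] W} {x : M} (hF : HasFDerivAt F F' (φ x))
    (hφ : MDifferentiableAt I 𝓘(ℝ, V) φ x) (v : TangentSpace I x) :
    mvfderiv I (F ∘ φ) x v = F' (mvfderiv I φ x v) := by
  have h := hF.hasMFDerivAt.comp x hφ.hasMFDerivAt
  exact congrArg (fun L : E →L[ℝ] W => L v) h.mfderiv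

variable {m : ℕ}

/-- Differentiate ‖θ‖² = 1. This kills the cross terms between radial and spherical directions. -/
theorem inner_mvfderiv_coe_sphere (p : Spc m) (v : TangentSpace (SpcModel m) p) :
    inner ℝ (p.2.2 : EuclideanSpace ℝ (Fin (m + 1)))
      (mvfderiv (SpcModel m) (fun q : Spc m => (q.2.2 : EuclideanSpace ℝ (Fin (m + 1)))) p v)
      = 0 := by
  have h := mvfderiv_comp_eq_fderiv (φ := fun q : Spc m => (q.2.2 : EuclideanSpace ℝ (Fin (m + 1))))
    (F := fun y => ‖y‖ ^ 2) (hasStrictFDerivAt_norm_sq _).hasFDerivAt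
    ((contMDiff_coe_snd_snd.mdifferentiable (by simp)) p) v
  have h1 : (fun y => ‖y‖ ^ 2) ∘ (fun q : Spc m => (q.2.2 : EuclideanSpace ℝ (Fin (m + 1)))) =
      fun _ => (1 : ℝ) := by
    funext q
    simp
  rw [h1] at h
  have h2 : mvfderiv (SpcModel m) (fun _ : Spc m => (1 : ℝ)) p v = 0 :=
    congrArg (fun L : (ℝ × ℝ × EuclideanSpace ℝ (Fin m)) →L[ℝ] ℝ => L v)
      (mfderiv_const (I := SpcModel m) (I' := 𝓘(ℝ, ℝ)) (c := (1 : ℝ)) (x := p))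
  have h3 := h.symm.trans h2
  have h4 : (2 : ℝ) * inner ℝ (p.2.2 : EuclideanSpace ℝ (Fin (m + 1)))
    (mvfderiv (SpcModel m) (fun q : Spc m => (q.2.2 : EuclideanSpace ℝ (Fin (m + 1)))) p v)
      = 0 := by
    rw [← h3]
    simp [two_smul, two_mul]
  linarith

variable {ρ f : ℝ → ℝ}

theorem mvfderiv_fst_mfderiv_cylinderEmbedding (hρ : ContDiff ℝ ∞ ρ) (p : Spc m)
    (v : TangentSpace (SpcModel m) p) :
    mvfderiv (𝓘(ℝ, ℝ).prod (𝓡 (m + 1))) (fun q : ℝ × PolarSphere m => q.1)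
      (cylinderEmbedding ρ p)
      (mfderiv (SpcModel m) (𝓘(ℝ, ℝ).prod (𝓡 (m + 1))) (cylinderEmbedding ρ) p v) =
    mvfderiv (SpcModel m) (fun q : Spc m => q.1) p v :=
  mvfderiv_mfderiv (contMDiff_fst_warped.mdifferentiable (by simp) _)
    ((contMDiff_cylinderEmbedding hρ).mdifferentiable (by simp) p) v

theorem mvfderiv_snd_fst_coe_cylinderEmbedding {ρ' : ℝ} (hρ : ContDiff ℝ ∞ ρ) (p : Spc m)
    (hd : HasDerivAt ρ ρ' p.2.1) (v : TangentSpace (SpcModel m) p) :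
    (mvfderiv (SpcModel m) (fun q : Spc m => ((cylinderEmbedding ρ q).2 : PolarSpace m)) p v).fst =
      (Real.cosh (ρ p.2.1) ^ 2)⁻¹ * ρ' * mvfderiv (SpcModel m) (fun q : Spc m => q.2.1) p v := by
  have h := mvfderiv_comp_eq_fderiv
    (φ := fun q : Spc m => ((cylinderEmbedding ρ q).2 : PolarSpace m))
    (WithLp.fstL 2 ℝ ℝ (EuclideanSpace ℝ (Fin (m + 1)))).hasFDerivAt
    ((contMDiff_coe_cylinderEmbedding hρ).mdifferentiable (by simp) p) v
  refine h.symm.trans ?_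
  have hc := (Real.cosh_pos (ρ p.2.1)).ne'
  have h1 : HasDerivAt (fun r => Real.tanh (ρ r)) ((Real.cosh (ρ p.2.1) ^ 2)⁻¹ * ρ') p.2.1 := by
    simp only [Real.tanh_eq_sinh_div_cosh]
    refine (hd.sinh.fun_div hd.cosh hc).congr_deriv ?_
    rw [div_eq_iff (pow_ne_zero 2 hc), mul_right_comm _ ρ' (_ ^ 2),
      inv_mul_cancel₀ (pow_ne_zero 2 hc)]
    linear_combination ρ' * Real.cosh_sq (ρ p.2.1)
  refine (mvfderiv_comp_eq_fderiv (φ := fun q : Spc m => q.2.1) h1.hasFDerivAt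
    ((contMDiff_snd_fst.mdifferentiable (by simp)) p) v).trans ?_
  simp [mul_comm]

theorem mvfderiv_snd_snd_coe_cylinderEmbedding {ρ' : ℝ} (hρ : ContDiff ℝ ∞ ρ) (p : Spc m)
    (hd : HasDerivAt ρ ρ' p.2.1) (v : TangentSpace (SpcModel m) p) :
    (mvfderiv (SpcModel m) (fun q : Spc m => ((cylinderEmbedding ρ q).2 : PolarSpace m)) p v).snd =
      (Real.cosh (ρ p.2.1))⁻¹ • mvfderiv (SpcModel m)
        (fun q : Spc m => (q.2.2 : EuclideanSpace ℝ (Fin (m + 1)))) p v +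
      (-(Real.sinh (ρ p.2.1) * ρ') / Real.cosh (ρ p.2.1) ^ 2 *
        mvfderiv (SpcModel m) (fun q : Spc m => q.2.1) p v) •
          (p.2.2 : EuclideanSpace ℝ (Fin (m + 1))) := by
  have h := mvfderiv_comp_eq_fderiv
    (φ := fun q : Spc m => ((cylinderEmbedding ρ q).2 : PolarSpace m))
    (WithLp.sndL 2 ℝ ℝ (EuclideanSpace ℝ (Fin (m + 1)))).hasFDerivAt
    ((contMDiff_coe_cylinderEmbedding hρ).mdifferentiable (by simp) p) v
  refine h.symm.trans ?_
  have hc := (Real.cosh_pos (ρ p.2.1)).ne'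
  have h1 : HasDerivAt (fun r => (Real.cosh (ρ r))⁻¹)
      (-(Real.sinh (ρ p.2.1) * ρ') / Real.cosh (ρ p.2.1) ^ 2) p.2.1 := hd.cosh.inv hc
  have hφ : MDifferentiableAt (SpcModel m) 𝓘(ℝ, ℝ × EuclideanSpace ℝ (Fin (m + 1)))
      (fun q : Spc m => (q.2.1, (q.2.2 : EuclideanSpace ℝ (Fin (m + 1))))) p :=
    (contMDiff_snd_fst.prodMk_space contMDiff_coe_snd_snd).mdifferentiable (by simp) p
  have hA := mvfderiv_comp_eq_fderiv (F := Prod.fst) hasFDerivAt_fst hφ v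
  have hB := mvfderiv_comp_eq_fderiv (F := Prod.snd) hasFDerivAt_snd hφ v
  have h2 := mvfderiv_comp_eq_fderiv (φ := fun q : Spc m =>
    (q.2.1, (q.2.2 : EuclideanSpace ℝ (Fin (m + 1)))))
    (HasFDerivAt.smul (h1.comp_hasFDerivAt
      (p.2.1, (p.2.2 : EuclideanSpace ℝ (Fin (m + 1)))) hasFDerivAt_fst) hasFDerivAt_snd) hφ v
  refine h2.trans ?_
  have hA' : mvfderiv (SpcModel m) (fun q : Spc m => q.2.1) p v = _ := hA
  have hB' : mvfderiv (SpcModel m)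
    (fun q : Spc m => (q.2.2 : EuclideanSpace ℝ (Fin (m + 1)))) p v = _ := hB
  rw [hA', hB']
  simp

theorem inner_polarSpace (x y : PolarSpace m) :
    inner ℝ x y = y.fst * x.fst + inner ℝ x.snd y.snd := WithLp.prod_inner_apply x y

/-- The radial coefficient is ρ'² (1 + sinh² ρ) / cosh⁴ ρ = 1 / (f cosh² ρ), the spherical one is 1
/ cosh² ρ, and the temporal one is w² = f / cosh² ρ: each is cosh⁻² ρ times its counterpart in the
static metric. -/
theorem conformal_cylinderEmbedding {w : PolarSphere m → ℝ} (hρ : ContDiff ℝ ∞ ρ)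
    (hpos : ∀ r, 0 < f r) (hd : ∀ r, HasDerivAt ρ (√(f r))⁻¹ r)
    (hw : ∀ p : Spc m, w (cylinderEmbedding ρ p).2 = √(f p.2.1) / Real.cosh (ρ p.2.1))
    (p : Spc m) (u v : TangentSpace (SpcModel m) p) :
    warpedMetric (m + 1) w (cylinderEmbedding ρ p)
      (mfderiv (SpcModel m) (𝓘(ℝ, ℝ).prod (𝓡 (m + 1))) (cylinderEmbedding ρ) p u)
      (mfderiv (SpcModel m) (𝓘(ℝ, ℝ).prod (𝓡 (m + 1))) (cylinderEmbedding ρ) p v) =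
    ‖(cylinderEmbedding ρ p).2.1.snd‖ ^ 2 * staticMetric m f p u v := by
  have hsnd : ∀ v : TangentSpace (SpcModel m) p,
      mvfderiv (𝓘(ℝ, ℝ).prod (𝓡 (m + 1))) (fun q : ℝ × PolarSphere m => (q.2 : PolarSpace m))
        (cylinderEmbedding ρ p)
        (mfderiv (SpcModel m) (𝓘(ℝ, ℝ).prod (𝓡 (m + 1))) (cylinderEmbedding ρ) p v) =
      mvfderiv (SpcModel m) (fun q : Spc m => ((cylinderEmbedding ρ q).2 : PolarSpace m)) p v :=
    fun v => mvfderiv_mfderiv (contMDiff_coe_snd_warped.mdifferentiable (by simp) _)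
      ((contMDiff_cylinderEmbedding hρ).mdifferentiable (by simp) p) v
  rw [warpedMetric_apply, hsnd, hsnd, mvfderiv_fst_mfderiv_cylinderEmbedding hρ,
    mvfderiv_fst_mfderiv_cylinderEmbedding hρ, inner_polarSpace, hw,
    staticMetric_apply]
  have e1 := mvfderiv_snd_fst_coe_cylinderEmbedding hρ p (hd p.2.1)
  have e2 := mvfderiv_snd_snd_coe_cylinderEmbedding hρ p (hd p.2.1)
  have hn : ‖(cylinderEmbedding ρ p).2.1.snd‖ = (Real.cosh (ρ p.2.1))⁻¹ :=
    norm_snd_cylinderToSphere _ _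
  have h0 := inner_mvfderiv_coe_sphere p
  rw [e1, e1, e2, e2, hn]
  generalize mvfderiv (SpcModel m) (fun q : Spc m => q.2.1) p u = A
  generalize mvfderiv (SpcModel m) (fun q : Spc m => q.2.1) p v = A'
  have hu := h0 u
  have hv := h0 v
  generalize mvfderiv (SpcModel m)
    (fun q : Spc m => (q.2.2 : EuclideanSpace ℝ (Fin (m + 1)))) p u = B at hu ⊢
  generalize mvfderiv (SpcModel m)
    (fun q : Spc m => (q.2.2 : EuclideanSpace ℝ (Fin (m + 1)))) p v = B' at hv ⊢
  have hu' := (real_inner_comm (p.2.2 : EuclideanSpace ℝ (Fin (m + 1))) B).trans hu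
  have hc := (Real.cosh_pos (ρ p.2.1)).ne'
  have hf := (Real.sqrt_pos.2 (hpos p.2.1)).ne'
  have hθ : inner ℝ (p.2.2 : EuclideanSpace ℝ (Fin (m + 1))) (p.2.2 : EuclideanSpace ℝ _) = 1 := by
    rw [real_inner_self_eq_norm_sq, norm_eq_of_mem_sphere, one_pow]
  rw [inner_add_left, inner_add_right, inner_add_right]
  simp only [real_inner_smul_left, real_inner_smul_right, hv, hu', hθ]
  have hff : f p.2.1 = √(f p.2.1) ^ 2 := (Real.sq_sqrt (hpos p.2.1).le).symm
  have hs := Real.cosh_sq (ρ p.2.1)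
  generalize √(f p.2.1) = b at *
  rw [hff]
  field_simp
  rw [hs]
  linear_combination b ^ 2 * inner ℝ B B' * hs

end Conformal

/-! ### The conformal factor near the ends -/

section Factor

variable {m : ℕ}

theorem isLipschitzFunction_norm_snd :
    IsLipschitzFunction (𝓘(ℝ, ℝ).prod (𝓡 (m + 1)))
      (fun q : ℝ × PolarSphere m => ‖q.2.1.snd‖) := by
  refine isLipschitzFunction_of_coe_snd (φ := fun x : PolarSpace m => ‖x.snd‖) ?_
  exact (lipschitzWith_one_norm.comp
    (WithLp.sndL 2 ℝ ℝ (EuclideanSpace ℝ (Fin (m + 1)))).lipschitz).locallyLipschitz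

/-- Off the axis the factor is the norm of a nonvanishing smooth map, hence differentiable, and a
Lipschitz constant in the chart bounds the differential. The set U is a time interval times a
neighborhood inside the open hemisphere of p, so it meets only one end curve, in an interval. -/
theorem norm_snd_differential_bounded {p : ℝ × PolarSphere m} (hp : p.2.1.snd = 0) :
    ∃ U : Set (ℝ × PolarSphere m), IsOpen U ∧ p ∈ U ∧
      U ⊆ (extChartAt (𝓘(ℝ, ℝ).prod (𝓡 (m + 1))) p).source ∧
      IsConnected (U ∩ {q | q.2.1.snd = 0}) ∧
      ∃ C : ℝ, ∀ q ∈ U \ {q | q.2.1.snd = 0},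
        DifferentiableAt ℝ ((fun q : ℝ × PolarSphere m => ‖q.2.1.snd‖) ∘
          (extChartAt (𝓘(ℝ, ℝ).prod (𝓡 (m + 1))) p).symm)
          (extChartAt (𝓘(ℝ, ℝ).prod (𝓡 (m + 1))) p q) ∧
        ‖fderiv ℝ ((fun q : ℝ × PolarSphere m => ‖q.2.1.snd‖) ∘
          (extChartAt (𝓘(ℝ, ℝ).prod (𝓡 (m + 1))) p).symm)
          (extChartAt (𝓘(ℝ, ℝ).prod (𝓡 (m + 1))) p q)‖ ≤ C := by
  have he := IsManifold.chart_mem_maximalAtlas (I := 𝓘(ℝ, ℝ).prod (𝓡 (m + 1))) (n := ∞) p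
  obtain ⟨K, u, hu, hK⟩ := isLipschitzFunction_norm_snd _ he
    (mem_extChartAt_target (I := 𝓘(ℝ, ℝ).prod (𝓡 (m + 1))) p)
  have hsnd : ContMDiff (𝓘(ℝ, ℝ).prod (𝓡 (m + 1))) 𝓘(ℝ, EuclideanSpace ℝ (Fin (m + 1))) ∞
      (fun q : ℝ × PolarSphere m => q.2.1.snd) :=
    contDiff_polarSpace_snd.contMDiff.comp contMDiff_coe_snd_warped
  have hsmooth := contDiffOn_comp_extend_symm hsnd he
  change ContDiffOn ℝ ∞ _ (extChartAt (𝓘(ℝ, ℝ).prod (𝓡 (m + 1))) p).target at hsmooth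
  change LipschitzOnWith K (_ ∘ (extChartAt (𝓘(ℝ, ℝ).prod (𝓡 (m + 1))) p).symm) u at hK
  change ContDiffOn ℝ ∞ (_ ∘ (extChartAt (𝓘(ℝ, ℝ).prod (𝓡 (m + 1))) p).symm) _ at hsmooth
  have ht : IsOpen (extChartAt (𝓘(ℝ, ℝ).prod (𝓡 (m + 1))) p).target := isOpen_extChartAt_target p
  have hu' : u ∈ 𝓝 (extChartAt (𝓘(ℝ, ℝ).prod (𝓡 (m + 1))) p p) := by
    rwa [← ht.nhdsWithin_eq (mem_extChartAt_target p)]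
  have hO := (continuousOn_extChartAt (I := 𝓘(ℝ, ℝ).prod (𝓡 (m + 1))) p).isOpen_inter_preimage
    (isOpen_extChartAt_source p) (isOpen_interior (s := u))
  have hpO := hO.mem_nhds ⟨mem_extChartAt_source p, mem_interior_iff_mem_nhds.2 hu'⟩
  obtain ⟨a, b, ha, hpa, hb, hpb, hab⟩ := mem_nhds_prod_iff'.1 hpO
  obtain ⟨r, hr, hra⟩ := Metric.isOpen_iff.1 ha _ hpa
  have hε : p.2.1.fst ^ 2 = 1 := by
    have h := p.2.sq_add_sq
    rw [hp, norm_zero] at h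
    linarith
  have hcont : Continuous fun x : PolarSphere m => p.2.1.fst * x.1.fst :=
    continuous_const.mul (contDiff_polarSpace_fst.continuous.comp continuous_subtype_val)
  have hUO : Metric.ball p.1 r ×ˢ (b ∩ {x | 0 < p.2.1.fst * x.1.fst}) ⊆
      (extChartAt (𝓘(ℝ, ℝ).prod (𝓡 (m + 1))) p).source ∩
        extChartAt (𝓘(ℝ, ℝ).prod (𝓡 (m + 1))) p ⁻¹' interior u :=
    (prod_mono hra inter_subset_left).trans hab
  refine ⟨Metric.ball p.1 r ×ˢ (b ∩ {x | 0 < p.2.1.fst * x.1.fst}),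
    Metric.isOpen_ball.prod (hb.inter (isOpen_lt continuous_const hcont)),
    ⟨Metric.mem_ball_self hr, hpb, ?_⟩, fun q hq => (hUO hq).1, ?_, K, fun q hq => ?_⟩
  · change 0 < p.2.1.fst * p.2.1.fst
    nlinarith
  · have himage : (Metric.ball p.1 r ×ˢ (b ∩ {x | 0 < p.2.1.fst * x.1.fst})) ∩
        {q | q.2.1.snd = 0} = (fun t : ℝ => (t, p.2)) '' Metric.ball p.1 r := by
      ext q
      constructor
      · rintro ⟨⟨hq1, -, hq2⟩, hq3⟩
        refine ⟨q.1, hq1, Prod.ext rfl ?_⟩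
        have hq4 : 0 < p.2.1.fst * q.2.1.fst := hq2
        have hfst : q.2.1.fst = p.2.1.fst := by
          rcases fst_eq_one_or_of_snd_eq_zero hp with h | h <;>
          rcases fst_eq_one_or_of_snd_eq_zero hq3 with h' | h' <;>
          rw [h, h'] at hq4 ⊢ <;> norm_num at hq4
        rw [eq_pole hp hε rfl, eq_pole hq3 hε hfst]
      · rintro ⟨t, ht, rfl⟩
        refine ⟨⟨ht, hpb, ?_⟩, hp⟩
        change 0 < p.2.1.fst * p.2.1.fst
        nlinarith
    rw [himage]
    exact ⟨⟨_, mem_image_of_mem _ (Metric.mem_ball_self hr)⟩,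
      (convex_ball p.1 r).isPreconnected.image _
        (Continuous.prodMk_left p.2).continuousOn⟩
  · have hq1 := hUO hq.1
    have hy := (extChartAt (𝓘(ℝ, ℝ).prod (𝓡 (m + 1))) p).map_source hq1.1
    refine ⟨?_, norm_fderiv_le_of_lipschitzOn ℝ (mem_interior_iff_mem_nhds.1 hq1.2) hK⟩
    refine DifferentiableAt.norm ℝ
      (((hsmooth _ hy).contDiffAt (ht.mem_nhds hy)).differentiableAt (by simp)) ?_
    rw [(extChartAt _ p).left_inv hq1.1]
    exact hq.2

end Factor

/-! ### Assembly of the conformal extension -/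

section Static

variable {m : ℕ} {ρ f : ℝ → ℝ}

theorem futureTimelike_mfderiv_timeField {w : PolarSphere m → ℝ} (hw0 : ∀ x, 0 < w x)
    (hρ : ContDiff ℝ ∞ ρ) (hm : 1 ≤ m) (hpos : ∀ r, 0 < f r)
    (hd : ∀ r, HasDerivAt ρ (√(f r))⁻¹ r)
    (hw : ∀ p : Spc m, w (cylinderEmbedding ρ p).2 = √(f p.2.1) / Real.cosh (ρ p.2.1))
    (p : Spc m) :
    FutureTimelike (𝓘(ℝ, ℝ).prod (𝓡 (m + 1))) (warpedMetric (m + 1) w)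
      (timeDirection (𝓡 (m + 1)) _) (cylinderEmbedding ρ p)
      (mfderiv (SpcModel m) (𝓘(ℝ, ℝ).prod (𝓡 (m + 1))) (cylinderEmbedding ρ) p
        (timeField m p)) := by
  constructor
  · rw [conformal_cylinderEmbedding hρ hpos hd hw]
    exact mul_neg_of_pos_of_neg
      (pow_pos (norm_pos_iff.2 (snd_cylinderEmbedding_ne_zero ρ p)) 2)
      ((isSpacetime_staticMetric hm hpos).timelike p)
  · rw [warpedMetric_apply, mvfderiv_fst_mfderiv_cylinderEmbedding hρ, mvfderiv_fst_timeField,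
      mvfderiv_fst_timeDirection]
    have h : mvfderiv (𝓘(ℝ, ℝ).prod (𝓡 (m + 1)))
        (fun q : ℝ × PolarSphere m => (q.2 : PolarSpace m)) (cylinderEmbedding ρ p)
        (timeDirection (𝓡 (m + 1)) _ (cylinderEmbedding ρ p)) = 0 :=
      mvfderiv_comp_snd_timeDirection (φ := fun x : PolarSphere m => (x : PolarSpace m)) _
        (mdifferentiableAt_coe_sphere _)
    rw [h, inner_zero_right]
    have := hw0 (cylinderEmbedding ρ p).2
    simp [pow_pos this 2]

theorem hasAdS2Ends_staticMetric (hm : 1 ≤ m) (hf : ContDiff ℝ ∞ f) (hpos : ∀ r, 0 < f r)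
    (ht : (fun r => f r - r ^ 2) =O[atTop] (fun r => r))
    (ht' : (fun r => deriv f r - 2 * r) =O[atTop] (fun _ => (1 : ℝ)))
    (hb : (fun r => f r - r ^ 2) =O[atBot] (fun r => r))
    (hb' : (fun r => deriv f r - 2 * r) =O[atBot] (fun _ => (1 : ℝ))) :
    HasAdS2Ends (SpcModel m) (m + 1) 2 (staticMetric m f) (timeField m) := by
  obtain ⟨ρ, hρ, hd, hρt, hρb, W, K, c, C, hc, hW, hWm, hWρ⟩ :=
    exists_radialCoordinate hf hpos ht ht' hb hb'
  obtain ⟨R, hR, h1, h2⟩ := exists_contDiff_inverse hρ hd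
    (fun r => inv_pos.2 (Real.sqrt_pos.2 (hpos r))) hρt hρb
  obtain ⟨K', hK'⟩ := lipschitzWith_comp_arcsin (m := m) hW
  obtain ⟨ω₀⟩ : Nonempty (Sph m) := (NormedSpace.sphere_nonempty.2 zero_le_one).to_subtype
  -- At the poles the latitude is ±π/2, outside the range of arctan ∘ sinh ∘ ρ; there w takes the
  -- values of the Lipschitz extension `W`.
  set w : PolarSphere m → ℝ := fun x => W (Real.arcsin x.1.fst) with hwdef
  have hw0 : ∀ x, 0 < w x := fun x => hc.trans_le (hWm _).1
  have hw : ∀ p : Spc m,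
      w (cylinderEmbedding ρ p).2 = √(f p.2.1) / Real.cosh (ρ p.2.1) := fun p => by
    rw [← hWρ, ← arcsin_fst_cylinderToSphere (ρ p.2.1) p.2.2]
    rfl
  refine ⟨one_le_two, isSpacetime_staticMetric hm hpos, isSmoothMetric_staticMetric hf hpos,
    ℝ × EuclideanSpace ℝ (Fin (m + 1)), inferInstance, inferInstance,
    ModelProd ℝ (EuclideanSpace ℝ (Fin (m + 1))), inferInstance, 𝓘(ℝ, ℝ).prod (𝓡 (m + 1)),
    ℝ × PolarSphere m, inferInstance, inferInstance, inferInstance,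
    warpedMetric (m + 1) w, timeDirection (𝓡 (m + 1)) _, cylinderEmbedding ρ,
    fun q => ‖q.2.1.snd‖, endCurve m, ?_⟩
  exact
    { spacetime := isSpacetime_warpedMetric (by omega) hw0
      lipschitz_metric := isLipschitzMetric_warpedMetric hK'.locallyLipschitz
      lipschitz_factor := isLipschitzFunction_norm_snd
      globallyHyperbolic := globallyHyperbolic_warpedMetric hw0 (fun x => (hWm _).2) hK'
      injective := Function.LeftInverse.injective (cylinderEmbeddingInv_cylinderEmbedding h1 ω₀)
      localDiffeomorph := isLocalDiffeomorph_cylinderEmbedding hρ hR h1 h2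
      timeOrientation := futureTimelike_mfderiv_timeField hw0 hρ hm hpos hd hw
      curves := fun i => isInextendibleTimelikeCurve_const (by omega) hw0 _
      disjoint := pairwise_disjoint_range_endCurve
      frontier_eq := by
        rw [iUnion_range_endCurve, frontier_range_cylinderEmbedding h2 ω₀]
      factor_smooth := by
        have h : (fun q : ℝ × PolarSphere m => ‖q.2.1.snd‖) ∘ cylinderEmbedding ρ =
            (fun r => (Real.cosh (ρ r))⁻¹) ∘ fun p : Spc m => p.2.1 :=
          funext fun p => norm_snd_cylinderToSphere _ _
        rw [h]
        have h3 : ContDiff ℝ ∞ fun r => (Real.cosh (ρ r))⁻¹ :=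
          hρ.cosh.inv fun r => (Real.cosh_pos _).ne'
        exact h3.contMDiff.comp contMDiff_snd_fst
      factor_pos := fun p => norm_pos_iff.2 (snd_cylinderEmbedding_ne_zero ρ p)
      factor_zero := by
        rw [iUnion_range_endCurve]
        exact fun q hq => norm_eq_zero.2 hq
      factor_differential_bounded := by
        rw [iUnion_range_endCurve]
        exact fun p hp => norm_snd_differential_bounded hp
      conformal := conformal_cylinderEmbedding hρ hpos hd hw }

end Static

end AdSEnds

theorem mainTheorem10 :
    (∀ (f : ℝ → ℝ) (r₀ : ℝ), ContDiffOn ℝ ∞ f (Ioi r₀) → (∀ r ∈ Ioi r₀, 0 < f r) →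
      (fun r => f r - r ^ 2) =O[atTop] (fun r => r) →
      (fun r => deriv f r - 2 * r) =O[atTop] (fun _ => (1 : ℝ)) →
      (fun x => AdSEnds.scaleFactor f x - x) =O[𝓝[>] 0] (fun x => x ^ 2) ∧
      (∀ᶠ x in 𝓝[>] 0, DifferentiableAt ℝ (AdSEnds.scaleFactor f) x) ∧
      (fun x => deriv (AdSEnds.scaleFactor f) x - 1) =O[𝓝[>] 0] (fun x => x)) ∧
    (∀ (n m : ℕ), 2 ≤ n → n = m + 1 →
      ∀ f : ℝ → ℝ, ContDiff ℝ ∞ f → (∀ r, 0 < f r) →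
      (fun r => f r - r ^ 2) =O[atTop] (fun r => r) →
      (fun r => deriv f r - 2 * r) =O[atTop] (fun _ => (1 : ℝ)) →
      (fun r => f r - r ^ 2) =O[atBot] (fun r => r) →
      (fun r => deriv f r - 2 * r) =O[atBot] (fun _ => (1 : ℝ)) →
      AdSEnds.HasAdS2Ends (AdSEnds.SpcModel m) n 2
        (AdSEnds.staticMetric m f) (AdSEnds.timeField m)) :=
  ⟨fun _ _ hf hpos ho ho' => AdSEnds.scaleFactor_asymptotics hf hpos ho ho',
    fun n m hn hnm f hf hpos ht ht' hb hb' => by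
      subst hnm
      exact AdSEnds.hasAdS2Ends_staticMetric (by omega) hf hpos ht ht' hb hb'⟩
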